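/- **Theorem (fermionic and bosonic duality).** Let $N\ge 1$ and $d$ be natural numbers, $\varepsilon>0$, and let $\mathfrak h=(\mathbb C^d)^{\otimes N}$. Let $\Pi_+$ and $\Pi_-$ be the orthogonal projections of $\mathfrak h$ onto the symmetric subspace $\mathfrak h_+=\bigodot_{i=1}^N\mathbb C^d$ and the antisymmetric subspace $\mathfrak h_-=\bigwedge_{i=1}^N\mathbb C^d$. For an operator $A$ on $\mathfrak h$ put $A_\pm:=\Pi_\pm A\,\Pi_\pm$, regarded as an operator on $\mathfrak h_\pm$; in particular $\exp(A_\pm)$ and its trace are taken on $\mathfrak h_\pm$. Operators on $\mathfrak h_\pm$ are identified with operators on $\mathfrak h$ through extension by zero. A density matrix is a positive semidefinite operator of trace one. For a density matrix $\Gamma$ on $\mathfrak h_\pm$ write $\Gamma\mapsto\gamma$ if all its one-particle marginals equal $\gamma$, i.e. $\operatorname{Tr}(\gamma A)=\operatorname{Tr}\big(\Gamma\,(1\otimes\dots\otimes A\otimes\dots\otimes 1)\big)$ for every operator $A$ on $\mathbb C^d$ and every position $i\in\{1,\dots,N\}$ of $A$. For Hermitian $U$ on $\mathbb C^d$ let $\bigoplus_{i=1}^N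 U=\sum_{i=1}^N 1\otimes\dots\otimes \underbrace{U}_{i}\otimes\dots\otimes 1$. Let $H$ be a Hermitian operator on $\mathfrak h$ that is invariant under all permutations of the $N$ tensor factors. For a density matrix $\gamma$ on $\mathbb C^d$ define (with $0\log 0=0$) $$\mathfrak F^\varepsilon_\pm(\gamma)=\inf\{\operatorname{Tr}(H\Gamma)+\varepsilon\operatorname{Tr}(\Gamma\log\Gamma)\;:\;\Gamma\text{ a density matrix on }\mathfrak h_\pm,\ \Gamma\mapsto\gamma\},$$ $$D^{\pm,\varepsilon}_\gamma(U)=\operatorname{Tr}(U\gamma)-\varepsilon\operatorname{Tr}\exp\Big(\tfrac1\varepsilon\Big[\tfrac1N\bigoplus_{i=1}^N U-H\Big]_\pm\Big)+\varepsilon,\qquad \mathfrak D^\varepsilon_\pm(\gamma)=\sup\{D^{\pm,\varepsilon}_\gamma(U): U\text{ Hermitian on }\mathbb C^d\}.$$ (i) *Fermions.* Let $\gamma$ be a density matrix on $\mathbb C^d$ with $\gamma\le\frac1N$ (which forces $N\le d$). Then $\mathfrak F^\varepsilon_-(\gamma)=\mathfrak D^\varepsilon_-(\gamma)$, and this value is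 finite. If moreover $0<\gamma<\frac1N$ (the strict Pauli principle), then $D^{-,\varepsilon}_\gamma$ has a unique Hermitian maximiser $U^\varepsilon_-$, and $$\Gamma^\varepsilon_-=\exp\Big(\tfrac1\varepsilon\Big[\tfrac1N\bigoplus_{i=1}^N U^\varepsilon_--H\Big]_-\Big)$$ is the unique minimiser in the problem defining $\mathfrak F^\varepsilon_-(\gamma)$. (ii) *Bosons.* For every density matrix $\gamma$ on $\mathbb C^d$, $\mathfrak F^\varepsilon_+(\gamma)=\mathfrak D^\varepsilon_+(\gamma)$, and this value is finite. If moreover $\gamma>0$, then $D^{+,\varepsilon}_\gamma$ has a unique Hermitian maximiser $U^\varepsilon_+$, and $$\Gamma^\varepsilon_+=\exp\Big(\tfrac1\varepsilon\Big[\tfrac1N\bigoplus_{i=1}^N U^\varepsilon_+-H\Big]_+\Big)$$ is the unique minimiser in the problem defining $\mathfrak F^\varepsilon_+(\gamma)$. -/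

import Mathlib

open scoped ComplexOrder

namespace QuantumOT

/-- Complex `d × d` matrices: the operators on the one-particle space `ℂ^d`. -/
abbrev OneBody (d : ℕ) := Matrix (Fin d) (Fin d) ℂ

/-- Operators on the `N`-fold tensor product `ℂ^d ⊗ ⋯ ⊗ ℂ^d`, as matrices in the product basis
`e_{x 0} ⊗ ⋯ ⊗ e_{x (N-1)}`, where `x : Fin N → Fin d`. -/
abbrev ManyBody (N d : ℕ) := Matrix (Fin N → Fin d) (Fin N → Fin d) ℂ

/-- The particle statistics: bosons (sign `+`) or fermions (sign `-`). -/
inductive Statistics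
  | boson
  | fermion

/-- The character of the permutation group: trivial for bosons, the signature for fermions. -/
def Statistics.character (s : Statistics) {N : ℕ} (σ : Equiv.Perm (Fin N)) : ℂ :=
  match s with
  | .boson => 1
  | .fermion => ((Equiv.Perm.sign σ : ℤ) : ℂ)

/-- Density matrices: positive semidefinite with trace one. -/
def IsDensity {ι : Type*} [Fintype ι] (A : Matrix ι ι ℂ) : Prop :=
  A.PosSemidef ∧ A.trace = 1

/-- `1 ⊗ ⋯ ⊗ 1 ⊗ A ⊗ 1 ⊗ ⋯ ⊗ 1`, with `A` in position `i`. -/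
def siteOp {N d : ℕ} (i : Fin N) (A : OneBody d) : ManyBody N d :=
  Matrix.of fun x y => A (x i) (y i) * ∏ j ∈ Finset.univ.erase i, if x j = y j then 1 else 0

/-- The Kronecker sum `U ⊕ ⋯ ⊕ U` of `N` copies of `U`. -/
def kroneckerSum (N : ℕ) {d : ℕ} (U : OneBody d) : ManyBody N d :=
  ∑ i : Fin N, siteOp i U

/-- `Γ ↦ γ`: every marginal (partial trace) of `Γ` equals `γ`. -/
def HasMarginals {N d : ℕ} (Γ : ManyBody N d) (γ : OneBody d) : Prop :=
  ∀ (i : Fin N) (A : OneBody d), (γ * A).trace = (Γ * siteOp i A).trace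

/-- Invariance under every permutation of the tensor factors: `H.submatrix (· ∘ σ) (· ∘ σ)` is the
image of `H` under the linear map that sends `⊗ⱼ Aⱼ` to `⊗ⱼ A_{σ⁻¹ j}`. -/
def IsPermSymmetric {N d : ℕ} (H : ManyBody N d) : Prop :=
  ∀ σ : Equiv.Perm (Fin N), H.submatrix (fun x => x ∘ σ) (fun x => x ∘ σ) = H

/-- The projection `Π_±` of the tensor product onto its symmetric / antisymmetric subspace:
`(1 / N!) ∑_σ χ(σ) P_σ`, where `(P_σ ψ) x = ψ (x ∘ σ)`. -/
noncomputable def symProj (s : Statistics) (N d : ℕ) : ManyBody N d :=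
  Matrix.of fun x y =>
    ((N.factorial : ℂ))⁻¹ * ∑ σ : Equiv.Perm (Fin N), if x ∘ σ = y then s.character σ else 0

/-- The projected operator `A_± = Π_± A Π_±`. -/
noncomputable def compress (s : Statistics) {N d : ℕ} (A : ManyBody N d) : ManyBody N d :=
  symProj s N d * A * symProj s N d

/-- The exponential of `A_±` as an operator on the symmetric / antisymmetric subspace, extended
by zero on the orthogonal complement. (The exponential of `A_±` on the whole tensor product is
block diagonal, and it is the identity on the complement; the factor `Π_±` removes that block.)
In particular its trace is the trace over the subspace. -/
noncomputable def sectorExp (s : Statistics) {N d : ℕ} (A : ManyBody N d) : ManyBody N d :=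
  symProj s N d * NormedSpace.exp (compress s A)

/-- Bosonic / fermionic density matrices: the density matrices on the symmetric / antisymmetric
subspace, seen as density matrices on the tensor product that live on that subspace. -/
def IsSectorDensity (s : Statistics) {N d : ℕ} (Γ : ManyBody N d) : Prop :=
  IsDensity Γ ∧ compress s Γ = Γ

/-- The primal functional `Tr(H Γ) + ε Tr(Γ log Γ)`, where `0 log 0 = 0`. -/
noncomputable def primalEnergy {N d : ℕ} (ε : ℝ) (H Γ : ManyBody N d) : ℝ :=
  (H * Γ).trace.re + ε * (Γ * cfc Real.log Γ).trace.re

/-- Competitors of the primal problem with marginal `γ`. -/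
def IsAdmissible (s : Statistics) {N d : ℕ} (γ : OneBody d) (Γ : ManyBody N d) : Prop :=
  IsSectorDensity s Γ ∧ HasMarginals Γ γ

/-- The value of the primal problem (`+∞` if there is no competitor). -/
noncomputable def primalValue (s : Statistics) {N d : ℕ} (ε : ℝ) (H : ManyBody N d)
    (γ : OneBody d) : EReal :=
  ⨅ (Γ : ManyBody N d) (_ : IsAdmissible s γ Γ), (primalEnergy ε H Γ : EReal)

/-- `Γ` solves the primal problem. -/
def IsPrimalMinimiser (s : Statistics) {N d : ℕ} (ε : ℝ) (H : ManyBody N d) (γ : OneBody d)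
    (Γ : ManyBody N d) : Prop :=
  IsAdmissible s γ Γ ∧
    ∀ Γ' : ManyBody N d, IsAdmissible s γ Γ' → primalEnergy ε H Γ ≤ primalEnergy ε H Γ'

/-- `exp (ε⁻¹ [N⁻¹ (U ⊕ ⋯ ⊕ U) - H]_±)` on the symmetric / antisymmetric subspace. -/
noncomputable def gibbs (s : Statistics) {N d : ℕ} (ε : ℝ) (H : ManyBody N d)
    (U : OneBody d) : ManyBody N d :=
  sectorExp s ((ε : ℂ)⁻¹ • ((N : ℂ)⁻¹ • kroneckerSum N U - H))

/-- The dual functional `Tr(U γ) - ε Tr(exp (ε⁻¹ [N⁻¹ (U ⊕ ⋯ ⊕ U) - H]_±)) + ε`. -/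
noncomputable def dualFunctional (s : Statistics) {N d : ℕ} (ε : ℝ) (H : ManyBody N d)
    (γ U : OneBody d) : ℝ :=
  (U * γ).trace.re - ε * (gibbs s ε H U).trace.re + ε

/-- The value of the dual problem: the supremum over Hermitian `U`. -/
noncomputable def dualValue (s : Statistics) {N d : ℕ} (ε : ℝ) (H : ManyBody N d)
    (γ : OneBody d) : EReal :=
  ⨆ (U : OneBody d) (_ : U.IsHermitian), (dualFunctional s ε H γ U : EReal)

/-- `U` maximises the dual functional over the Hermitian matrices. -/
def IsDualMaximiser (s : Statistics) {N d : ℕ} (ε : ℝ) (H : ManyBody N d) (γ U : OneBody d) :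
    Prop :=
  U.IsHermitian ∧
    ∀ V : OneBody d, V.IsHermitian → dualFunctional s ε H γ V ≤ dualFunctional s ε H γ U

/-- The primal and dual problems have the same, finite value. -/
def DualityHolds (s : Statistics) {N d : ℕ} (ε : ℝ) (H : ManyBody N d) (γ : OneBody d) : Prop :=
  primalValue s ε H γ = dualValue s ε H γ ∧ ∃ v : ℝ, primalValue s ε H γ = (v : EReal)

/-- There is exactly one dual maximiser `U`, and the associated exponential is the one and only
primal minimiser. -/
def UniqueOptimisers (s : Statistics) {N d : ℕ} (ε : ℝ) (H : ManyBody N d) (γ : OneBody d) :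
    Prop :=
  ∃ U : OneBody d,
    IsDualMaximiser s ε H γ U ∧
    (∀ V : OneBody d, IsDualMaximiser s ε H γ V → V = U) ∧
    IsPrimalMinimiser s ε H γ (gibbs s ε H U) ∧
    ∀ Γ : ManyBody N d, IsPrimalMinimiser s ε H γ Γ → Γ = gibbs s ε H U

end QuantumOT

open QuantumOT

/-! Everything rests on `klein_inequality`: on the range of a projection, `Tr Γ log Γ - Tr AΓ + Tr
e^A - Tr Γ ≥ 0`, with equality exactly when `Γ = e^A`. Taking for `A` the compressed exponent of the
Gibbs operator gives `gibbs_variational`. Every dual value is then at most every primal energy, and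
the two agree only if the competitor is the Gibbs operator of the potential. So a potential whose
Gibbs operator has marginal `γ` solves both problems, and `euler_lagrange` says that a dual
maximiser is such a potential.

For `γ` on the boundary a maximiser may fail to exist. The dual is then penalised by `η/2 Tr U²`. It
is bounded above as soon as one competitor exists, so penalised maximisers exist, and their Gibbs
operators have marginal `γ - ηU` with `ηU → 0`. A limit point as `η → 0` is a competitor whose
energy is at most the dual value (`exists_admissible_le_of_forall_le`), which closes the gap without
a minimax theorem.

For `γ` in the interior, `γ + δE` is still a marginal for each Hermitian `E` and some `δ > 0`.
Testing weak duality on these perturbations bounds the dual superlevel set, so a maximiser exists.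
The equality case of Klein's inequality then gives both uniqueness claims.

What remains is to know which `γ` are marginals. Bosons use powers of eigenvectors. Fermions use
Slater determinants, mixed according to Birkhoff's theorem. -/

namespace QuantumOT

open Matrix

/-! ### Klein's inequality by eigenbasis expansion -/

section Spectral

variable {ι : Type*} [Fintype ι] [DecidableEq ι]

/-- The matrix with the spectral data `a` in the orthonormal basis of the columns of `V`. -/
def spectralSum (V : Matrix ι ι ℂ) (a : ι → ℝ) : Matrix ι ι ℂ :=
  V * diagonal (fun i => (a i : ℂ)) * Vᴴ

lemma exists_spectralSum {A : Matrix ι ι ℂ} (hA : A.IsHermitian) :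
    ∃ (V : Matrix ι ι ℂ), V * Vᴴ = 1 ∧ Vᴴ * V = 1 ∧
      A = spectralSum V hA.eigenvalues ∧
      ∀ f : ℝ → ℝ, cfc f A = spectralSum V (fun i => f (hA.eigenvalues i)) := by
  refine ⟨hA.eigenvectorUnitary, ?_, ?_, ?_, fun f => ?_⟩
  · exact Unitary.coe_mul_star_self hA.eigenvectorUnitary
  · exact Unitary.coe_star_mul_self hA.eigenvectorUnitary
  · conv_lhs => rw [hA.spectral_theorem]
    rfl
  · rw [hA.cfc_eq]
    rfl

lemma exp_eq_cfc {A : Matrix ι ι ℂ} (hA : A.IsHermitian) :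
    NormedSpace.exp A = cfc Real.exp A := by
  obtain ⟨V, hV, hV', h, hf⟩ := exists_spectralSum hA
  have hinv : V⁻¹ = Vᴴ := Matrix.inv_eq_left_inv hV'
  have hu : IsUnit V := IsUnit.of_mul_eq_one _ hV
  rw [hf]
  conv_lhs => rw [h]
  rw [spectralSum, ← hinv, Matrix.exp_conj _ _ hu, Matrix.exp_diagonal, hinv, spectralSum]
  congr 3
  funext i
  rw [Pi.coe_exp, ← Complex.exp_eq_exp_ℂ, Complex.ofReal_exp]

/-- Two eigenbases interact only through the nonnegative weights `|⟨v_i, X w_j⟩|²`; this turns trace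
inequalities into scalar ones. -/
lemma trace_spectralSum_mul (V W X : Matrix ι ι ℂ) (a b : ι → ℝ) :
    (spectralSum V a * X * spectralSum W b * Xᴴ).trace.re =
      ∑ i, ∑ j, a i * b j * Complex.normSq ((Vᴴ * X * W) i j) := by
  have h : (spectralSum V a * X * spectralSum W b * Xᴴ).trace =
      (diagonal (fun i => (a i : ℂ)) * ((Vᴴ * X * W) * diagonal (fun i => (b i : ℂ)) *
        (Vᴴ * X * W)ᴴ)).trace := by
    simp only [spectralSum, conjTranspose_mul, conjTranspose_conjTranspose, Matrix.mul_assoc]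
    rw [Matrix.trace_mul_comm]
    simp only [Matrix.mul_assoc]
  rw [h, Matrix.trace, Complex.re_sum]
  refine Finset.sum_congr rfl fun i _ => ?_
  rw [diag_apply, diagonal_mul, Matrix.mul_apply, Complex.re_ofReal_mul, Complex.re_sum,
    Finset.mul_sum]
  refine Finset.sum_congr rfl fun j _ => ?_
  rw [mul_diagonal, conjTranspose_apply, mul_right_comm, Complex.star_def, Complex.mul_conj,
    mul_comm ((Complex.normSq _ : ℝ) : ℂ), ← Complex.ofReal_mul, Complex.ofReal_re,
    ← mul_assoc (a i)]

lemma mul_spectralSum_mul_apply {V W : Matrix ι ι ℂ} (hW : Wᴴ * W = 1) (X : Matrix ι ι ℂ)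
    (b : ι → ℝ) (i j : ι) :
    (Vᴴ * (X * spectralSum W b) * W) i j = (Vᴴ * X * W) i j * b j := by
  have : Vᴴ * (X * spectralSum W b) * W = (Vᴴ * X * W) * diagonal (fun i => (b i : ℂ)) := by
    simp only [spectralSum, Matrix.mul_assoc, hW, Matrix.mul_one]
  rw [this, mul_diagonal]

lemma mul_spectralSum_mul_apply' {V W : Matrix ι ι ℂ} (hV : Vᴴ * V = 1) (X : Matrix ι ι ℂ)
    (a : ι → ℝ) (i j : ι) :
    (Vᴴ * (spectralSum V a * X) * W) i j = a i * (Vᴴ * X * W) i j := by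
  have : Vᴴ * (spectralSum V a * X) * W = diagonal (fun i => (a i : ℂ)) * (Vᴴ * X * W) := by
    simp only [spectralSum, Matrix.mul_assoc]
    rw [← Matrix.mul_assoc, hV, Matrix.one_mul]
  rw [this, diagonal_mul]

/-- This is `1 + t ≤ e^t` at `t = a - log x`, multiplied by `x`; at `x = 0` only `e^a` survives. -/
lemma mul_log_sub_add_exp_nonneg {x : ℝ} (hx : 0 ≤ x) (a : ℝ) :
    0 ≤ x * Real.log x - x * a + Real.exp a - x := by
  rcases hx.eq_or_lt with rfl | hx
  · simpa using (Real.exp_pos a).le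
  · have h := Real.add_one_le_exp (a - Real.log x)
    rw [Real.exp_sub, Real.exp_log hx, le_div_iff₀ hx] at h
    nlinarith

lemma mul_log_sub_add_exp_eq_zero {x : ℝ} (hx : 0 ≤ x) {a : ℝ}
    (h : x * Real.log x - x * a + Real.exp a - x = 0) : x = Real.exp a := by
  rcases hx.eq_or_lt with rfl | hx
  · simp at h
  · by_contra hne
    have hne' : a - Real.log x ≠ 0 := by
      intro h0
      apply hne
      rw [sub_eq_zero.1 h0, Real.exp_log hx]
    have h1 := Real.add_one_lt_exp hne'
    rw [Real.exp_sub, Real.exp_log hx, lt_div_iff₀ hx] at h1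
    nlinarith

/-- **Klein's inequality** on the range of a projection `P`, with its case of equality. -/
theorem klein_inequality {P A Γ : Matrix ι ι ℂ} (hP : P.IsHermitian) (hPP : P * P = P)
    (hA : A.IsHermitian) (hPA : P * A * P = A) (hΓ : Γ.PosSemidef) (hPΓ : P * Γ * P = Γ) :
    0 ≤ (Γ * cfc Real.log Γ).trace.re - (A * Γ).trace.re +
        (P * NormedSpace.exp A).trace.re - Γ.trace.re ∧
      ((Γ * cfc Real.log Γ).trace.re - (A * Γ).trace.re +
        (P * NormedSpace.exp A).trace.re - Γ.trace.re = 0 ↔ Γ = P * NormedSpace.exp A) := by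
  have hΓP : Γ * P = Γ := by rw [← hPΓ, Matrix.mul_assoc, hPP]
  have hPΓ' : P * Γ = Γ := by rw [← hPΓ, ← Matrix.mul_assoc, ← Matrix.mul_assoc, hPP]
  have hAP : A * P = A := by rw [← hPA, Matrix.mul_assoc, hPP]
  have hPA' : P * A = A := by rw [← hPA, ← Matrix.mul_assoc, ← Matrix.mul_assoc, hPP]
  rw [exp_eq_cfc hA]
  obtain ⟨V, hV, hV', hAV, hfA⟩ := exists_spectralSum hA
  obtain ⟨W, hW, hW', hΓW, hfΓ⟩ := exists_spectralSum hΓ.1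
  set a := hA.eigenvalues
  set g := hΓ.1.eigenvalues
  have hg : ∀ j, 0 ≤ g j := hΓ.eigenvalues_nonneg
  -- Placing `P` between the two eigenbases discards the part of `e^A` off the range of `P`.
  set m : ι → ι → ℝ := fun i j => Complex.normSq ((Vᴴ * P * W) i j) with hm
  have hone : ∀ U : Matrix ι ι ℂ, U * Uᴴ = 1 → spectralSum U (fun _ => 1) = 1 := by
    intro U hU
    simp [spectralSum, hU]
  have key : ∀ (b c : ι → ℝ), (spectralSum V b * P * spectralSum W c * P).trace.re =
      ∑ i, ∑ j, b i * c j * m i j := by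
    intro b c
    have := trace_spectralSum_mul V W P b c
    rwa [hP.eq] at this
  have e1 : (Γ * cfc Real.log Γ).trace.re = ∑ i, ∑ j, g j * Real.log (g j) * m i j := by
    have hprod : Γ * cfc Real.log Γ = spectralSum W (fun j => g j * Real.log (g j)) := by
      rw [hfΓ]
      conv_lhs => rw [hΓW]
      simp only [spectralSum]
      rw [show ∀ X Y : Matrix ι ι ℂ, W * X * Wᴴ * (W * Y * Wᴴ) = W * X * (Wᴴ * W) * Y * Wᴴ by
        intro X Y; simp only [Matrix.mul_assoc], hW', Matrix.mul_one, Matrix.mul_assoc W,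
        diagonal_mul_diagonal]
      simp
    have h2 := key (fun _ => 1) (fun j => g j * Real.log (g j))
    rw [hone V hV, ← hprod, Matrix.one_mul, ← Matrix.mul_assoc, hPΓ', Matrix.trace_mul_comm,
      ← Matrix.mul_assoc, hPΓ'] at h2
    simpa using h2
  have e2 : (A * Γ).trace.re = ∑ i, ∑ j, a i * g j * m i j := by
    have h2 := key a g
    rwa [← hAV, ← hΓW, hAP, Matrix.mul_assoc, hΓP] at h2
  have e3 : (P * cfc Real.exp A).trace.re = ∑ i, ∑ j, Real.exp (a i) * m i j := by
    have h2 := key (fun i => Real.exp (a i)) (fun _ => 1)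
    rw [← hfA, hone W hW, Matrix.mul_one, Matrix.mul_assoc, hPP, Matrix.trace_mul_comm] at h2
    simpa using h2
  have e4 : Γ.trace.re = ∑ i, ∑ j, g j * m i j := by
    have h2 := key (fun _ => 1) g
    rw [← hΓW, hone V hV, Matrix.one_mul, hPΓ', hΓP] at h2
    simpa using h2
  have e5 : (Γ * cfc Real.log Γ).trace.re - (A * Γ).trace.re +
        (P * cfc Real.exp A).trace.re - Γ.trace.re =
      ∑ i, ∑ j, (g j * Real.log (g j) - g j * a i + Real.exp (a i) - g j) * m i j := by
    rw [e1, e2, e3, e4]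
    simp only [← Finset.sum_sub_distrib, ← Finset.sum_add_distrib]
    refine Finset.sum_congr rfl fun i _ => Finset.sum_congr rfl fun j _ => ?_
    ring
  have hm0 : ∀ i j, 0 ≤ m i j := fun i j => Complex.normSq_nonneg _
  have hterm : ∀ i j, 0 ≤ (g j * Real.log (g j) - g j * a i + Real.exp (a i) - g j) * m i j :=
    fun i j => mul_nonneg (mul_log_sub_add_exp_nonneg (hg j) _) (hm0 i j)
  have hcomm : cfc Real.exp A * P = P * cfc Real.exp A :=
    ((show Commute A P from hAP.trans hPA'.symm).cfc_real Real.exp).eq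
  -- Equality is tested entrywise in the mixed bases: where the overlap vanishes both sides are
  -- zero, and elsewhere it says `g j = e^{a i}`, which is the scalar equality case.
  have hentry : Γ = P * cfc Real.exp A ↔
      ∀ i j, (Vᴴ * P * W) i j * g j = Real.exp (a i) * (Vᴴ * P * W) i j := by
    have h1 : ∀ i j, (Vᴴ * Γ * W) i j = (Vᴴ * P * W) i j * g j := by
      intro i j
      rw [← mul_spectralSum_mul_apply hW', ← hΓW, hPΓ']
    have h2 : ∀ i j, (Vᴴ * (P * cfc Real.exp A) * W) i j =
        Real.exp (a i) * (Vᴴ * P * W) i j := by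
      intro i j
      rw [← hcomm, hfA, mul_spectralSum_mul_apply' hV']
    constructor
    · intro h i j
      rw [← h1, ← h2, ← h]
    · intro h
      have h3 : Vᴴ * Γ * W = Vᴴ * (P * cfc Real.exp A) * W := by
        ext i j
        rw [h1, h2, h]
      have h4 : ∀ X : Matrix ι ι ℂ, V * (Vᴴ * X * W) * Wᴴ = X := by
        intro X
        rw [show V * (Vᴴ * X * W) * Wᴴ = (V * Vᴴ) * X * (W * Wᴴ) by
          simp only [Matrix.mul_assoc], hV, hW, Matrix.one_mul, Matrix.mul_one]
      rw [← h4 Γ, h3, h4]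
  rw [e5]
  refine ⟨Finset.sum_nonneg fun i _ => Finset.sum_nonneg fun j _ => hterm i j, ?_⟩
  rw [hentry, Finset.sum_eq_zero_iff_of_nonneg
    (fun i _ => Finset.sum_nonneg fun j _ => hterm i j)]
  constructor
  · intro h i j
    have h0 := (Finset.sum_eq_zero_iff_of_nonneg (fun j _ => hterm i j)).1
      (h i (Finset.mem_univ _)) j (Finset.mem_univ _)
    rcases mul_eq_zero.1 h0 with h0 | h0
    · rw [mul_log_sub_add_exp_eq_zero (hg j) h0, mul_comm]
    · rw [Complex.normSq_eq_zero.1 h0, zero_mul, mul_zero]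
  · intro h i _
    refine Finset.sum_eq_zero fun j _ => ?_
    by_cases h0 : (Vᴴ * P * W) i j = 0
    · simp [hm, h0]
    · have h1 := h i j
      rw [mul_comm] at h1
      have h2 : g j = Real.exp (a i) := by exact_mod_cast mul_right_cancel₀ h0 h1
      rw [h2, Real.log_exp]
      ring

end Spectral

end QuantumOT

namespace QuantumOT

open Matrix Filter Topology

/-! ### Compactness and continuity of the entropy -/

section Topological

variable {ι : Type*} [Fintype ι] [DecidableEq ι]

omit [DecidableEq ι] in
lemma isClosed_setOf_posSemidef : IsClosed {M : Matrix ι ι ℂ | M.PosSemidef} := by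
  simp only [Matrix.posSemidef_iff_dotProduct_mulVec, Set.ofPred_and, Set.ofPred_forall]
  refine IsClosed.inter (isClosed_eq (by fun_prop) (by fun_prop)) (isClosed_iInter fun x => ?_)
  exact isClosed_le continuous_const (by fun_prop)

lemma spectrum_subset_Icc {M : Matrix ι ι ℂ} (hM : M.PosSemidef) {K : ℝ}
    (hK : M.trace.re ≤ K) : spectrum ℝ M ⊆ Set.Icc 0 K := by
  rw [hM.1.spectrum_real_eq_range_eigenvalues]
  rintro _ ⟨i, rfl⟩
  refine ⟨hM.eigenvalues_nonneg i, le_trans ?_ hK⟩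
  rw [hM.1.trace_eq_sum_eigenvalues, Complex.re_sum]
  exact Finset.single_le_sum (f := fun i => hM.1.eigenvalues i)
    (fun i _ => hM.eigenvalues_nonneg i) (Finset.mem_univ i)

open scoped Matrix.Norms.L2Operator in
lemma continuous_matrix_exp : Continuous (fun M : Matrix ι ι ℂ => NormedSpace.exp M) :=
  let +nondep : NormedAlgebra ℚ (Matrix ι ι ℂ) := .restrictScalars ℚ ℂ _
  NormedSpace.exp_continuous

open scoped Matrix.Norms.L2Operator in
lemma isCompact_posSemidef_trace_le (K : ℝ) :
    IsCompact {M : Matrix ι ι ℂ | M.PosSemidef ∧ M.trace.re ≤ K} := by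
  have : ProperSpace (Matrix ι ι ℂ) := FiniteDimensional.proper ℂ _
  refine Metric.isCompact_of_isClosed_isBounded ?_ ?_
  · rw [Set.ofPred_and]
    refine isClosed_setOf_posSemidef.inter (isClosed_le ?_ continuous_const)
    exact Complex.continuous_re.comp (Continuous.matrix_trace continuous_id)
  · refine (Metric.isBounded_closedBall (x := (0 : Matrix ι ι ℂ)) (r := |K|)).subset ?_
    rintro M ⟨hM, hK⟩
    have hsa : IsSelfAdjoint M := hM.1
    rw [mem_closedBall_zero_iff, ← cfc_id ℝ M hsa]
    refine norm_cfc_le (abs_nonneg K) fun x hx => ?_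
    have h := spectrum_subset_Icc hM hK hx
    rw [id, Real.norm_eq_abs, abs_of_nonneg h.1]
    exact h.2.trans (le_abs_self K)

-- `log` is discontinuous at `0`, but `x log x` is continuous on `[0, K]`, which contains all the
-- spectra; the product is its functional calculus because each spectrum is finite.
open scoped Matrix.Norms.L2Operator in
lemma continuousOn_mul_cfc_log (K : ℝ) :
    ContinuousOn (fun M : Matrix ι ι ℂ => M * cfc Real.log M)
      {M : Matrix ι ι ℂ | M.PosSemidef ∧ M.trace.re ≤ K} := by
  have h : ContinuousOn (fun M : Matrix ι ι ℂ => cfc (fun x => x * Real.log x) M)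
      {M : Matrix ι ι ℂ | M.PosSemidef ∧ M.trace.re ≤ K} :=
    ContinuousOn.cfc' (isCompact_Icc (a := 0) (b := K)) _ continuousOn_id
      (fun M hM => spectrum_subset_Icc hM.1 hM.2) (fun M hM => hM.1.1)
      Real.continuous_mul_log.continuousOn
  refine h.congr fun M hM => ?_
  have hsa : IsSelfAdjoint M := hM.1.1
  have hfin : (spectrum ℝ M).Finite := Matrix.finite_real_spectrum
  dsimp only
  rw [cfc_mul (fun x => x) Real.log M continuousOn_id (hfin.continuousOn _), cfc_id' ℝ M]

end Topological

end QuantumOT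

namespace QuantumOT

open Matrix

/-! ### Permutation operators and the projection onto a sector -/

section Permutations

variable {N d : ℕ}

lemma Statistics.character_mul (s : Statistics) (σ τ : Equiv.Perm (Fin N)) :
    s.character (σ * τ) = s.character σ * s.character τ := by
  cases s <;> simp [Statistics.character]

lemma Statistics.character_mul_self (s : Statistics) (σ : Equiv.Perm (Fin N)) :
    s.character σ * s.character σ = 1 := by
  cases s
  · simp [Statistics.character]
  · rcases Int.units_eq_one_or (Equiv.Perm.sign σ) with h | h <;> simp [Statistics.character, h]

lemma Statistics.character_inv (s : Statistics) (σ : Equiv.Perm (Fin N)) :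
    s.character σ⁻¹ = s.character σ := by
  cases s <;> simp [Statistics.character]

lemma Statistics.star_character (s : Statistics) (σ : Equiv.Perm (Fin N)) :
    star (s.character σ) = s.character σ := by
  cases s <;> simp [Statistics.character]

lemma Statistics.character_one (s : Statistics) :
    s.character (1 : Equiv.Perm (Fin N)) = 1 := by
  cases s <;> simp [Statistics.character]

/-- The matrix of the permutation operator `(P_σ ψ) x = ψ (x ∘ σ)`. -/
def permMat (d : ℕ) (σ : Equiv.Perm (Fin N)) : ManyBody N d :=
  Matrix.of fun x y => if x ∘ σ = y then 1 else 0

lemma permMat_mul_apply (σ : Equiv.Perm (Fin N)) (A : ManyBody N d) (x y : Fin N → Fin d) :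
    (permMat d σ * A) x y = A (x ∘ σ) y := by
  simp [Matrix.mul_apply, permMat]

lemma mul_permMat_apply (σ : Equiv.Perm (Fin N)) (A : ManyBody N d) (x y : Fin N → Fin d) :
    (A * permMat d σ) x y = A x (y ∘ ⇑σ⁻¹) := by
  have h : ∀ z : Fin N → Fin d, z ∘ σ = y ↔ z = y ∘ ⇑σ⁻¹ := by
    intro z
    constructor
    · rintro rfl
      funext i
      simp
    · rintro rfl
      funext i
      simp
  simp [Matrix.mul_apply, permMat, h]

lemma permMat_mul (σ τ : Equiv.Perm (Fin N)) :
    permMat d σ * permMat d τ = permMat d (σ * τ) := by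
  ext x y
  rw [permMat_mul_apply]
  rfl

lemma permMat_one : permMat d (1 : Equiv.Perm (Fin N)) = 1 := by
  ext x y
  simp [permMat, Matrix.one_apply]

lemma permMat_conjTranspose (σ : Equiv.Perm (Fin N)) :
    (permMat d σ)ᴴ = permMat d σ⁻¹ := by
  ext x y
  have h : y ∘ σ = x ↔ x ∘ ⇑σ⁻¹ = y := by
    constructor
    · rintro rfl
      funext i
      simp
    · rintro rfl
      funext i
      simp
  simp only [conjTranspose_apply, permMat, of_apply, h]
  split_ifs <;> simp

lemma symProj_eq_sum (s : Statistics) (N d : ℕ) :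
    symProj s N d =
      ((N.factorial : ℂ))⁻¹ • ∑ σ : Equiv.Perm (Fin N), s.character σ • permMat d σ := by
  ext x y
  simp [symProj, permMat, Matrix.sum_apply]

lemma permMat_mul_symProj (s : Statistics) (τ : Equiv.Perm (Fin N)) :
    permMat d τ * symProj s N d = s.character τ • symProj s N d := by
  rw [symProj_eq_sum, Matrix.mul_smul, smul_comm]
  congr 1
  rw [Matrix.mul_sum, Finset.smul_sum]
  refine Fintype.sum_equiv (Equiv.mulLeft τ) _ _ fun σ => ?_
  rw [Matrix.mul_smul, permMat_mul, Equiv.coe_mulLeft, s.character_mul, smul_smul, ← mul_assoc,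
    s.character_mul_self, one_mul]

lemma symProj_mul_permMat (s : Statistics) (τ : Equiv.Perm (Fin N)) :
    symProj s N d * permMat d τ = s.character τ • symProj s N d := by
  rw [symProj_eq_sum, Matrix.smul_mul, smul_comm]
  congr 1
  rw [Matrix.sum_mul, Finset.smul_sum]
  refine Fintype.sum_equiv (Equiv.mulRight τ) _ _ fun σ => ?_
  rw [Matrix.smul_mul, permMat_mul, Equiv.coe_mulRight, s.character_mul, smul_smul,
    mul_left_comm, s.character_mul_self, mul_one]

lemma symProj_mul_self (s : Statistics) (N d : ℕ) :
    symProj s N d * symProj s N d = symProj s N d := by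
  have h : ((N.factorial : ℂ)) ≠ 0 := by exact_mod_cast N.factorial_ne_zero
  conv_lhs => enter [1]; rw [symProj_eq_sum]
  rw [Matrix.smul_mul, Matrix.sum_mul]
  have : ∀ σ : Equiv.Perm (Fin N), (s.character σ • permMat d σ) * symProj s N d =
      symProj s N d := by
    intro σ
    rw [Matrix.smul_mul, permMat_mul_symProj, smul_smul, s.character_mul_self, one_smul]
  simp only [this, Finset.sum_const, Finset.card_univ, Fintype.card_perm, Fintype.card_fin]
  rw [← Nat.cast_smul_eq_nsmul ℂ, smul_smul, inv_mul_cancel₀ h, one_smul]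

lemma isHermitian_symProj (s : Statistics) (N d : ℕ) : (symProj s N d).IsHermitian := by
  rw [Matrix.IsHermitian, symProj_eq_sum, conjTranspose_smul, conjTranspose_sum, star_inv₀,
    star_natCast]
  congr 1
  refine Fintype.sum_equiv (Equiv.inv _) _ _ fun σ => ?_
  rw [conjTranspose_smul, permMat_conjTranspose, s.star_character, Equiv.inv_apply,
    s.character_inv]

lemma commute_symProj (s : Statistics) {A : ManyBody N d}
    (hA : ∀ σ, permMat d σ * A = A * permMat d σ) :
    symProj s N d * A = A * symProj s N d := by
  rw [symProj_eq_sum, Matrix.smul_mul, Matrix.mul_smul, Matrix.sum_mul, Matrix.mul_sum]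
  congr 1
  refine Finset.sum_congr rfl fun σ _ => ?_
  rw [Matrix.smul_mul, Matrix.mul_smul, hA]

/-- The character appears once on each side and squares to one, so fermionic operators are invariant
as well. -/
lemma permMat_conj_of_compress (s : Statistics) {Γ : ManyBody N d} (hΓ : compress s Γ = Γ)
    (σ : Equiv.Perm (Fin N)) : permMat d σ⁻¹ * Γ * permMat d σ = Γ := by
  rw [← hΓ, compress]
  simp only [Matrix.mul_assoc]
  rw [symProj_mul_permMat, ← Matrix.mul_assoc, permMat_mul_symProj, s.character_inv]
  simp only [Matrix.mul_smul, Matrix.smul_mul, smul_smul, s.character_mul_self, one_smul]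

lemma compress_compress (s : Statistics) (A : ManyBody N d) :
    compress s (compress s A) = compress s A := by
  simp only [compress, Matrix.mul_assoc]
  rw [symProj_mul_self, ← Matrix.mul_assoc, symProj_mul_self]

lemma isHermitian_compress (s : Statistics) {A : ManyBody N d} (hA : A.IsHermitian) :
    (compress s A).IsHermitian := by
  rw [compress, Matrix.IsHermitian, conjTranspose_mul, conjTranspose_mul, hA.eq,
    (isHermitian_symProj s N d).eq, Matrix.mul_assoc]

lemma trace_compress_mul (s : Statistics) (A : ManyBody N d) {Γ : ManyBody N d}
    (hΓ : compress s Γ = Γ) : (compress s A * Γ).trace = (A * Γ).trace := by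
  conv_rhs => rw [← hΓ]
  rw [compress, compress, Matrix.mul_assoc, Matrix.mul_assoc, Matrix.trace_mul_comm]
  simp only [Matrix.mul_assoc]

end Permutations

/-! ### One-body operators and marginals -/

section Tensor

variable {N d : ℕ}

/-- The tensor product `A 0 ⊗ ⋯ ⊗ A (N - 1)`. -/
def tensorOp (A : Fin N → OneBody d) : ManyBody N d :=
  Matrix.of fun x y => ∏ i, A i (x i) (y i)

lemma tensorOp_mul (A B : Fin N → OneBody d) :
    tensorOp A * tensorOp B = tensorOp (fun i => A i * B i) := by
  ext x z
  simp only [tensorOp, Matrix.mul_apply, of_apply, ← Finset.prod_mul_distrib]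
  rw [Finset.prod_univ_sum, Fintype.piFinset_univ]

lemma tensorOp_conjTranspose (A : Fin N → OneBody d) :
    (tensorOp A)ᴴ = tensorOp (fun i => (A i)ᴴ) := by
  ext x y
  simp [tensorOp, conjTranspose_apply]

lemma tensorOp_one : tensorOp (fun _ : Fin N => (1 : OneBody d)) = 1 := by
  ext x y
  simp only [tensorOp, of_apply, Matrix.one_apply, Finset.prod_ite_zero, Finset.prod_const_one,
    Finset.mem_univ, true_imp_iff, funext_iff]

lemma siteOp_eq_tensorOp (i : Fin N) (A : OneBody d) :
    siteOp i A = tensorOp (Function.update (fun _ => 1) i A) := by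
  ext x y
  simp only [siteOp, tensorOp, of_apply]
  rw [← Finset.mul_prod_erase Finset.univ _ (Finset.mem_univ i), Function.update_self]
  congr 1
  refine Finset.prod_congr rfl fun j hj => ?_
  rw [Function.update_of_ne (Finset.ne_of_mem_erase hj), Matrix.one_apply]

lemma permMat_mul_tensorOp (σ : Equiv.Perm (Fin N)) (A : Fin N → OneBody d) :
    permMat d σ * tensorOp A = tensorOp (fun i => A (σ⁻¹ i)) * permMat d σ := by
  ext x y
  rw [permMat_mul_apply, mul_permMat_apply]
  simp only [tensorOp, of_apply, Function.comp_apply]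
  refine Fintype.prod_equiv σ _ _ fun i => ?_
  simp

lemma permMat_mul_siteOp (σ : Equiv.Perm (Fin N)) (i : Fin N) (A : OneBody d) :
    permMat d σ * siteOp i A = siteOp (σ i) A * permMat d σ := by
  rw [siteOp_eq_tensorOp, siteOp_eq_tensorOp, permMat_mul_tensorOp]
  congr 2
  funext j
  by_cases h : j = σ i
  · subst h
    simp
  · have h' : σ⁻¹ j ≠ i := by
      rintro rfl
      simp at h
    rw [Function.update_of_ne h, Function.update_of_ne h']

lemma permMat_mul_kroneckerSum (σ : Equiv.Perm (Fin N)) (A : OneBody d) :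
    permMat d σ * kroneckerSum N A = kroneckerSum N A * permMat d σ := by
  rw [kroneckerSum, Matrix.mul_sum, Matrix.sum_mul]
  exact Fintype.sum_equiv σ _ _ fun i => permMat_mul_siteOp σ i A

lemma siteOp_add (i : Fin N) (A B : OneBody d) : siteOp i (A + B) = siteOp i A + siteOp i B := by
  ext x y
  simp [siteOp, add_mul]

lemma siteOp_smul (i : Fin N) (c : ℂ) (A : OneBody d) : siteOp i (c • A) = c • siteOp i A := by
  ext x y
  simp [siteOp, mul_assoc]

lemma siteOp_one (i : Fin N) : siteOp i (1 : OneBody d) = 1 := by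
  rw [siteOp_eq_tensorOp, ← tensorOp_one]
  congr 1
  exact Function.update_eq_self i _

lemma siteOp_conjTranspose (i : Fin N) (A : OneBody d) : (siteOp i A)ᴴ = siteOp i Aᴴ := by
  rw [siteOp_eq_tensorOp, siteOp_eq_tensorOp, tensorOp_conjTranspose]
  congr 1
  funext j
  by_cases h : j = i
  · subst h
    simp
  · simp [Function.update_of_ne h]

lemma siteOp_conj_tensorOp (i : Fin N) (A : OneBody d) {W : OneBody d} (hW : Wᴴ * W = 1) :
    (tensorOp fun _ : Fin N => W)ᴴ * siteOp i A * tensorOp (fun _ => W) =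
      siteOp i (Wᴴ * A * W) := by
  rw [siteOp_eq_tensorOp, siteOp_eq_tensorOp, tensorOp_conjTranspose, tensorOp_mul, tensorOp_mul]
  congr 1
  funext j
  by_cases h : j = i
  · subst h
    simp
  · simp [Function.update_of_ne h, hW]

variable (N) in
/-- The Kronecker sum as a linear map. -/
def kroneckerSumHom (d : ℕ) : OneBody d →ₗ[ℂ] ManyBody N d where
  toFun := kroneckerSum N
  map_add' A B := by simp [kroneckerSum, siteOp_add, Finset.sum_add_distrib]
  map_smul' c A := by simp [kroneckerSum, siteOp_smul, Finset.smul_sum]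

lemma kroneckerSum_add (A B : OneBody d) :
    kroneckerSum N (A + B) = kroneckerSum N A + kroneckerSum N B :=
  (kroneckerSumHom N d).map_add A B

lemma kroneckerSum_sub (A B : OneBody d) :
    kroneckerSum N (A - B) = kroneckerSum N A - kroneckerSum N B :=
  (kroneckerSumHom N d).map_sub A B

lemma kroneckerSum_smul (c : ℂ) (A : OneBody d) :
    kroneckerSum N (c • A) = c • kroneckerSum N A :=
  (kroneckerSumHom N d).map_smul c A

lemma continuous_kroneckerSum : Continuous (kroneckerSum N : OneBody d → ManyBody N d) :=
  (kroneckerSumHom N d).continuous_of_finiteDimensional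

lemma kroneckerSum_one : kroneckerSum N (1 : OneBody d) = (N : ℂ) • 1 := by
  simp [kroneckerSum, siteOp_one, Nat.cast_smul_eq_nsmul]

lemma isHermitian_kroneckerSum {A : OneBody d} (hA : A.IsHermitian) :
    (kroneckerSum N A).IsHermitian := by
  rw [Matrix.IsHermitian, kroneckerSum, conjTranspose_sum]
  simp only [siteOp_conjTranspose, hA.eq]

lemma HasMarginals.trace_kroneckerSum {Γ : ManyBody N d} {γ : OneBody d} (h : HasMarginals Γ γ)
    (A : OneBody d) : (Γ * kroneckerSum N A).trace = N * (γ * A).trace := by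
  rw [kroneckerSum, Matrix.mul_sum, Matrix.trace_sum]
  rw [Finset.sum_congr rfl fun i _ => (h i A).symm]
  simp

/-- The marginals of an operator on the symmetric or antisymmetric subspace agree. -/
lemma hasMarginals_of_trace_kroneckerSum (s : Statistics) {Γ : ManyBody N d} {γ : OneBody d}
    (hΓ : compress s Γ = Γ)
    (h : ∀ A : OneBody d, (Γ * kroneckerSum N A).trace = N * (γ * A).trace) :
    HasMarginals Γ γ := by
  intro i A
  have hN : (N : ℂ) ≠ 0 := by
    have : N ≠ 0 := by
      rintro rfl
      exact i.elim0
    exact_mod_cast this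
  -- The transposition of `i` and `j` carries one site operator to the other and leaves `Γ` fixed.
  have hsite : ∀ j, (Γ * siteOp j A).trace = (Γ * siteOp i A).trace := by
    intro j
    set σ := Equiv.swap i j with hσ
    have h1 : siteOp j A = permMat d σ * siteOp i A * permMat d σ⁻¹ := by
      rw [permMat_mul_siteOp, Matrix.mul_assoc, permMat_mul, mul_inv_cancel, permMat_one,
        Matrix.mul_one, hσ, Equiv.swap_apply_left]
    conv_rhs => rw [← permMat_conj_of_compress s hΓ σ]
    rw [h1, ← Matrix.mul_assoc, Matrix.trace_mul_comm]
    simp only [Matrix.mul_assoc]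
  have h2 := h A
  rw [kroneckerSum, Matrix.mul_sum, Matrix.trace_sum, Finset.sum_congr rfl fun j _ => hsite j] at h2
  simp only [Finset.sum_const, Finset.card_univ, Fintype.card_fin, nsmul_eq_mul] at h2
  exact (mul_left_cancel₀ hN h2).symm

end Tensor

end QuantumOT

namespace QuantumOT

open Matrix

/-! ### Stability of positivity under small perturbations -/

section Perturbation

variable {ι : Type*} [Fintype ι] [DecidableEq ι]

lemma posSemidef_sub_smul_one {A : Matrix ι ι ℂ} (hA : A.IsHermitian) {c : ℝ}
    (hc : ∀ i, c ≤ hA.eigenvalues i) : (A - (c : ℂ) • (1 : Matrix ι ι ℂ)).PosSemidef := by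
  obtain ⟨V, hV, -, hAV, -⟩ := exists_spectralSum hA
  have h : A - (c : ℂ) • (1 : Matrix ι ι ℂ) =
      V * diagonal (fun i => ((hA.eigenvalues i - c : ℝ) : ℂ)) * Vᴴ := by
    have : diagonal (fun i => ((hA.eigenvalues i - c : ℝ) : ℂ)) =
        diagonal (fun i => (hA.eigenvalues i : ℂ)) - (c : ℂ) • (1 : Matrix ι ι ℂ) := by
      rw [smul_one_eq_diagonal, diagonal_sub]
      simp
    rw [this, Matrix.mul_sub, Matrix.sub_mul, Matrix.mul_smul, Matrix.smul_mul, Matrix.mul_one,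
      hV]
    conv_lhs => rw [hAV]
    rfl
  rw [h]
  refine (PosSemidef.diagonal fun i => ?_).mul_mul_conjTranspose_same V
  exact Complex.zero_le_real.2 (sub_nonneg.2 (hc i))

/-- If `A ≥ c` and `E ≥ -K`, then `A + δE ≥ c - δK`, which is nonnegative for `δ ≤ c / (K + 1)`; the
`+ 1` keeps the denominator positive. -/
lemma exists_posSemidef_add_smul {A E : Matrix ι ι ℂ} (hA : A.PosDef) (hE : E.IsHermitian) :
    ∃ δ₀ : ℝ, 0 < δ₀ ∧ ∀ δ : ℝ, 0 ≤ δ → δ ≤ δ₀ → (A + (δ : ℂ) • E).PosSemidef := by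
  obtain ⟨c, hc, hcA⟩ : ∃ c : ℝ, 0 < c ∧ ∀ i, c ≤ hA.1.eigenvalues i := by
    rcases isEmpty_or_nonempty ι with h | h
    · exact ⟨1, one_pos, fun i => h.elim i⟩
    · obtain ⟨i, hi⟩ := Finite.exists_min hA.1.eigenvalues
      exact ⟨_, hA.eigenvalues_pos i, hi⟩
  set K : ℝ := ∑ i, |hE.eigenvalues i| with hK
  have hK0 : 0 ≤ K := Finset.sum_nonneg fun i _ => abs_nonneg _
  have hKE : ∀ i, -K ≤ hE.eigenvalues i := fun i =>
    neg_le_of_neg_le (((neg_le_abs _)).trans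
      (Finset.single_le_sum (f := fun i => |hE.eigenvalues i|) (fun i _ => abs_nonneg _)
        (Finset.mem_univ i)))
  refine ⟨c / (K + 1), by positivity, fun δ hδ hδ' => ?_⟩
  rw [le_div_iff₀ (by positivity)] at hδ'
  have h1 := posSemidef_sub_smul_one hA.1 hcA
  have h2 := (posSemidef_sub_smul_one hE hKE).smul (a := (δ : ℂ)) (Complex.zero_le_real.2 hδ)
  have h3 : (((c - δ * K : ℝ) : ℂ) • (1 : Matrix ι ι ℂ)).PosSemidef :=
    PosSemidef.one.smul (Complex.zero_le_real.2 (by nlinarith))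
  have h4 : A + (δ : ℂ) • E = (A - (c : ℂ) • (1 : Matrix ι ι ℂ)) +
      (δ : ℂ) • (E - ((-K : ℝ) : ℂ) • (1 : Matrix ι ι ℂ)) +
      ((c - δ * K : ℝ) : ℂ) • (1 : Matrix ι ι ℂ) := by
    push_cast
    module
  rw [h4]
  exact (h1.add h2).add h3

end Perturbation

/-! ### Which one-body matrices are marginals -/

section Representability

variable {N d : ℕ}

/-- `γ` is the one-particle marginal of a positive operator on the symmetric or antisymmetric
subspace. -/
def IsRepresentable (s : Statistics) (N : ℕ) {d : ℕ} (γ : OneBody d) : Prop :=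
  ∃ Γ : ManyBody N d, Γ.PosSemidef ∧ compress s Γ = Γ ∧ HasMarginals Γ γ

lemma IsRepresentable.smul {s : Statistics} {γ : OneBody d} (h : IsRepresentable s N γ) {c : ℝ}
    (hc : 0 ≤ c) : IsRepresentable s N ((c : ℂ) • γ) := by
  obtain ⟨Γ, h1, h2, h3⟩ := h
  refine ⟨(c : ℂ) • Γ, h1.smul (Complex.zero_le_real.2 hc), ?_, fun i A => ?_⟩
  · rw [compress, Matrix.mul_smul, Matrix.smul_mul]
    exact congrArg _ h2
  · rw [Matrix.smul_mul, Matrix.smul_mul, trace_smul, trace_smul, h3 i A]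

lemma HasMarginals.trace_eq {Γ : ManyBody N d} {γ : OneBody d} (hN : 1 ≤ N)
    (h : HasMarginals Γ γ) : Γ.trace = γ.trace := by
  have := h ⟨0, hN⟩ 1
  rwa [siteOp_one, Matrix.mul_one, Matrix.mul_one, eq_comm] at this

lemma siteOp_apply_self (i : Fin N) (B : OneBody d) (x : Fin N → Fin d) :
    siteOp i B x x = B (x i) (x i) := by
  simp [siteOp]

lemma kroneckerSum_apply_self (B : OneBody d) (x : Fin N → Fin d) :
    kroneckerSum N B x x = ∑ i, B (x i) (x i) := by
  simp [kroneckerSum, Matrix.sum_apply, siteOp_apply_self]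

/-- A mixture of (anti)symmetrised product states in the orthonormal basis of the columns of `W`
represents a matrix that is diagonal in this basis. -/
lemma isRepresentable_of_configurations (s : Statistics) {κ : Type*} [Fintype κ]
    {W : OneBody d} (hW : Wᴴ * W = 1)
    (X : κ → Fin N → Fin d) {w : κ → ℝ} (hw : ∀ k, 0 ≤ w k) {c : ℝ} (hc : 0 ≤ c) {l : Fin d → ℝ}
    (hl : ∀ a, ∑ k, ∑ i, (if X k i = a then w k else 0) = N * l a)
    (hdiag : ∀ k (B : OneBody d), (c : ℂ) * (symProj s N d * kroneckerSum N B) (X k) (X k) =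
      ∑ i, B (X k i) (X k i)) :
    IsRepresentable s N (spectralSum W l) := by
  set P := symProj s N d with hPdef
  have hP : Pᴴ = P := isHermitian_symProj s N d
  have hPP : P * P = P := symProj_mul_self s N d
  set T : ManyBody N d := tensorOp (fun _ => W) with hT
  have hTP : P * T = T * P := commute_symProj s fun σ => permMat_mul_tensorOp σ _
  have hTP' : P * Tᴴ = Tᴴ * P := by
    have := congrArg conjTranspose hTP
    rw [conjTranspose_mul, conjTranspose_mul, hP] at this
    exact this.symm
  have hkP : ∀ B, P * kroneckerSum N B = kroneckerSum N B * P := fun B =>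
    commute_symProj s fun σ => permMat_mul_kroneckerSum σ B
  -- The representing operator will be `c T P D P Tᴴ`: `D` mixes the product basis vectors `e_{X
  -- k}`, `P` symmetrises them, `c` normalises them, and `T` rotates the coordinate basis to the
  -- columns of `W`.
  set D : ManyBody N d := ∑ k, (w k : ℂ) • diagonal (Pi.single (X k) 1) with hD
  have hDpos : D.PosSemidef := by
    refine posSemidef_sum _ fun k _ => ?_
    refine (PosSemidef.diagonal fun x => ?_).smul (Complex.zero_le_real.2 (hw k))
    by_cases h : x = X k
    · subst h
      simp
    · simp [h]
  have hDtr : ∀ M : ManyBody N d, (D * M).trace = ∑ k, (w k : ℂ) * M (X k) (X k) := by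
    intro M
    rw [hD, Matrix.sum_mul, trace_sum]
    refine Finset.sum_congr rfl fun k _ => ?_
    rw [Matrix.smul_mul, trace_smul, smul_eq_mul, Matrix.trace]
    congr 1
    rw [Finset.sum_eq_single (X k)]
    · simp
    · intro x _ hx
      simp [hx]
    · simp
  have hcomp : compress s (T * ((c : ℂ) • (P * D * P)) * Tᴴ) =
      T * ((c : ℂ) • (P * D * P)) * Tᴴ := by
    rw [compress, ← hPdef]
    have h1 : P * (T * ((c : ℂ) • (P * D * P)) * Tᴴ) * P =
        (P * T) * ((c : ℂ) • (P * D * P)) * (Tᴴ * P) := by simp only [Matrix.mul_assoc]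
    have h2 : T * P * ((c : ℂ) • (P * D * P)) * (P * Tᴴ) =
        T * ((c : ℂ) • ((P * P) * D * (P * P))) * Tᴴ := by
      simp only [Matrix.mul_assoc, Matrix.mul_smul, Matrix.smul_mul]
    rw [h1, hTP, ← hTP', h2, hPP]
  refine ⟨T * ((c : ℂ) • (P * D * P)) * Tᴴ, ?_, hcomp,
    hasMarginals_of_trace_kroneckerSum s hcomp fun A => ?_⟩
  · refine PosSemidef.mul_mul_conjTranspose_same ?_ T
    have := (hDpos.mul_mul_conjTranspose_same P).smul (Complex.zero_le_real.2 hc)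
    rwa [hP] at this
  · set B := Wᴴ * A * W with hB
    have hconj : Tᴴ * kroneckerSum N A * T = kroneckerSum N B := by
      rw [kroneckerSum, kroneckerSum, Matrix.mul_sum, Matrix.sum_mul]
      exact Finset.sum_congr rfl fun i _ => siteOp_conj_tensorOp i A hW
    have h1 : (T * ((c : ℂ) • (P * D * P)) * Tᴴ * kroneckerSum N A).trace =
        c * (D * (P * kroneckerSum N B)).trace := by
      calc _ = (((c : ℂ) • (P * D * P)) * (Tᴴ * kroneckerSum N A * T)).trace := by
            rw [Matrix.mul_assoc, Matrix.mul_assoc, Matrix.trace_mul_comm]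
            simp only [Matrix.mul_assoc]
        _ = c * (P * (D * P * kroneckerSum N B)).trace := by
            rw [hconj, Matrix.smul_mul, trace_smul, smul_eq_mul]
            simp only [Matrix.mul_assoc]
        _ = c * (D * (P * kroneckerSum N B)).trace := by
            rw [Matrix.trace_mul_comm, Matrix.mul_assoc, Matrix.mul_assoc, ← hkP,
              ← Matrix.mul_assoc P, hPP]
    have h2 : (spectralSum W l * A).trace = ∑ a, (l a : ℂ) * B a a := by
      have : (spectralSum W l * A).trace = (diagonal (fun a => (l a : ℂ)) * B).trace := by
        rw [spectralSum, hB, Matrix.mul_assoc, Matrix.mul_assoc, Matrix.trace_mul_comm]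
        simp only [Matrix.mul_assoc]
      rw [this, Matrix.trace]
      simp
    rw [h1, h2, hDtr, Finset.mul_sum, Finset.mul_sum]
    calc ∑ k, (c : ℂ) * ((w k : ℂ) * (P * kroneckerSum N B) (X k) (X k))
        = ∑ k, (w k : ℂ) * ∑ i, B (X k i) (X k i) := by
          refine Finset.sum_congr rfl fun k _ => ?_
          rw [mul_left_comm, hdiag]
      _ = ∑ k, ∑ i, ∑ a, (if X k i = a then (w k : ℂ) else 0) * B a a := by
          refine Finset.sum_congr rfl fun k _ => ?_
          rw [Finset.mul_sum]
          refine Finset.sum_congr rfl fun i _ => ?_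
          simp
      _ = ∑ a, (∑ k, ∑ i, (if X k i = a then (w k : ℂ) else 0)) * B a a := by
          rw [Finset.sum_congr rfl fun k _ => Finset.sum_comm, Finset.sum_comm]
          simp only [Finset.sum_mul]
      _ = ∑ a, (N : ℂ) * ((l a : ℂ) * B a a) := by
          refine Finset.sum_congr rfl fun a _ => ?_
          rw [← mul_assoc]
          congr 1
          have := congrArg (fun r : ℝ => (r : ℂ)) (hl a)
          push_cast [apply_ite] at this
          exact this

/-- The `N`-th tensor powers of eigenvectors are already symmetric unit vectors; mixing them with
the eigenvalues as weights needs no upper bound on `γ`. -/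
theorem isRepresentable_boson (N : ℕ) {γ : OneBody d} (hγ : γ.PosSemidef) :
    IsRepresentable .boson N γ := by
  obtain ⟨W, -, hW, hγW, -⟩ := exists_spectralSum hγ.1
  rw [hγW]
  refine isRepresentable_of_configurations .boson hW (fun a _ => a) (w := hγ.1.eigenvalues)
    hγ.eigenvalues_nonneg zero_le_one (fun a => by simp) fun a B => ?_
  have hf : ((N.factorial : ℂ)) ≠ 0 := by exact_mod_cast N.factorial_ne_zero
  rw [symProj_eq_sum, Matrix.smul_mul, Matrix.sum_mul, Matrix.smul_apply, Matrix.sum_apply]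
  have : ∀ σ : Equiv.Perm (Fin N), ((Statistics.boson.character σ • permMat d σ) *
      kroneckerSum N B) (fun _ => a) (fun _ => a) = ∑ _i : Fin N, B a a := by
    intro σ
    rw [Matrix.smul_mul, Matrix.smul_apply, permMat_mul_apply, ← kroneckerSum_apply_self]
    simp [Statistics.character, Function.comp_def]
  rw [Finset.sum_congr rfl fun σ _ => this σ, Finset.sum_const, Finset.card_univ,
    Fintype.card_perm, Fintype.card_fin, nsmul_eq_mul, smul_eq_mul, inv_mul_cancel_left₀ hf]
  simp

/-- A one-body operator alters at most one coordinate, whereas a nontrivial permutation of distinct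
labels alters at least two. Exchange terms of Slater determinants therefore vanish. -/
lemma kroneckerSum_comp_perm_apply (B : OneBody d) {x : Fin N → Fin d}
    (hx : Function.Injective x) {σ : Equiv.Perm (Fin N)} (hσ : σ ≠ 1) :
    kroneckerSum N B (x ∘ σ) x = 0 := by
  rw [kroneckerSum, Matrix.sum_apply]
  refine Finset.sum_eq_zero fun i _ => ?_
  obtain ⟨j, hji, hj⟩ : ∃ j, j ≠ i ∧ σ j ≠ j := by
    by_contra! h
    apply hσ
    ext j
    by_cases hji : j = i
    · subst hji
      by_contra hne
      have h1 : σ j ≠ j := fun h => hne (by simp [h])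
      exact h1 (σ.injective (h _ h1))
    · simp [h j hji]
  simp only [siteOp, of_apply]
  rw [Finset.prod_eq_zero (Finset.mem_erase.2 ⟨hji, Finset.mem_univ j⟩), mul_zero]
  rw [if_neg]
  exact fun h => hj (hx h)

/-- Every point of the hypersimplex is a mixture of indicators of injective configurations. -/
lemma exists_configurations {l : Fin d → ℝ} (h0 : ∀ a, 0 ≤ l a)
    (h1 : ∀ a, N * l a ≤ 1) (hsum : ∑ a, l a = 1) :
    ∃ (X : Equiv.Perm (Fin d) → Fin N → Fin d) (w : Equiv.Perm (Fin d) → ℝ),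
      (∀ k, Function.Injective (X k)) ∧ (∀ k, 0 ≤ w k) ∧
      ∀ a, ∑ k, ∑ i, (if X k i = a then w k else 0) = N * l a := by
  have hdef : ∑ a, (1 - N * l a) = (d : ℝ) - N := by
    rw [Finset.sum_sub_distrib, ← Finset.mul_sum, hsum]
    simp
  have hNd' : (N : ℝ) ≤ d := by
    have : 0 ≤ ∑ a, (1 - N * l a) := Finset.sum_nonneg fun a _ => sub_nonneg.2 (h1 a)
    linarith
  have hNd : N ≤ d := by exact_mod_cast hNd'
  -- `N` rows equal to `l` leave the deficit `1 - N l a` in column `a`, shared equally by the other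
  -- `d - N` rows; for `d = N` there are no such rows.
  set M : Matrix (Fin d) (Fin d) ℝ :=
    Matrix.of fun i a => if (i : ℕ) < N then l a else (1 - N * l a) / ((d : ℝ) - N) with hM
  have hMds : M ∈ doublyStochastic ℝ (Fin d) := by
    rw [mem_doublyStochastic_iff_sum]
    refine ⟨fun i a => ?_, fun i => ?_, fun a => ?_⟩
    · simp only [hM, of_apply]
      split_ifs
      · exact h0 a
      · exact div_nonneg (sub_nonneg.2 (h1 a)) (sub_nonneg.2 hNd')
    · simp only [hM, of_apply]
      split_ifs with hi
      · exact hsum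
      · have hlt : (N : ℝ) < d := by exact_mod_cast (not_lt.1 hi).trans_lt i.2
        rw [← Finset.sum_div, hdef, div_self (sub_ne_zero.2 hlt.ne')]
    · simp only [hM, of_apply]
      have hc1 : (Finset.univ.filter fun i : Fin d => (i : ℕ) < N).card = N := by
        rw [Fin.card_filter_val_lt, min_eq_right hNd]
      have hc2 : (Finset.univ.filter fun i : Fin d => ¬ (i : ℕ) < N).card = d - N := by
        have := Finset.card_filter_add_card_filter_not (s := Finset.univ)
          (fun i : Fin d => (i : ℕ) < N)
        rw [hc1, Finset.card_univ, Fintype.card_fin] at this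
        omega
      rw [Finset.sum_ite, Finset.sum_const, Finset.sum_const, hc1, hc2, nsmul_eq_mul,
        nsmul_eq_mul, Nat.cast_sub hNd]
      rcases hNd'.eq_or_lt with heq | hlt
      · have hz : ∑ a, (1 - N * l a) = 0 := by rw [hdef, heq, sub_self]
        have := (Finset.sum_eq_zero_iff_of_nonneg fun a _ => sub_nonneg.2 (h1 a)).1 hz a
          (Finset.mem_univ a)
        rw [this, zero_div, mul_zero, add_zero]
        linarith
      · rw [mul_div_cancel₀ _ (sub_ne_zero.2 hlt.ne')]
        ring
  -- Birkhoff's theorem: `M` is a mixture of permutation matrices, and the first `N` values of each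
  -- permutation form an injective configuration.
  obtain ⟨w, hw0, -, hw⟩ := exists_eq_sum_perm_of_mem_doublyStochastic hMds
  refine ⟨fun σ i => σ (Fin.castLE hNd i), w,
    fun σ => σ.injective.comp (Fin.castLE_injective hNd), hw0, fun a => ?_⟩
  rw [Finset.sum_comm]
  have hrow : ∀ i : Fin N, ∑ σ, (if σ (Fin.castLE hNd i) = a then w σ else 0) = l a := by
    intro i
    have h2 : M (Fin.castLE hNd i) a = l a := by simp [hM]
    rw [← h2, ← hw, Matrix.sum_apply]
    refine Finset.sum_congr rfl fun σ _ => ?_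
    simp [PEquiv.toMatrix_apply, Equiv.toPEquiv_apply, eq_comm]
  rw [Finset.sum_congr rfl fun i _ => hrow i]
  simp

/-- The bound `γ ≤ 1/N` puts the eigenvalues, times `N`, in the hypersimplex, so `γ` is the marginal
of a mixture of Slater determinants of eigenvectors. -/
lemma isRepresentable_fermion_of_trace_eq_one (hN : 1 ≤ N) {γ : OneBody d} (hγ : γ.PosSemidef)
    (htr : γ.trace = 1) (hP : ((N : ℂ)⁻¹ • (1 : OneBody d) - γ).PosSemidef) :
    IsRepresentable .fermion N γ := by
  obtain ⟨W, -, hW, hγW, -⟩ := exists_spectralSum hγ.1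
  set l := hγ.1.eigenvalues with hl
  have hN0 : (0 : ℝ) < N := by exact_mod_cast hN
  have h1 : ∀ a, N * l a ≤ 1 := by
    intro a
    have h2 : Wᴴ * ((N : ℂ)⁻¹ • (1 : OneBody d) - γ) * W =
        diagonal (fun a => (((N : ℝ)⁻¹ - l a : ℝ) : ℂ)) := by
      rw [hγW, Matrix.mul_sub, Matrix.sub_mul, Matrix.mul_smul, Matrix.smul_mul, Matrix.mul_one,
        hW, spectralSum]
      rw [show ∀ D : OneBody d, Wᴴ * (W * D * Wᴴ) * W = (Wᴴ * W) * D * (Wᴴ * W) by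
        intro D; simp only [Matrix.mul_assoc], hW, Matrix.one_mul, Matrix.mul_one,
        smul_one_eq_diagonal, diagonal_sub]
      simp
    have h3 := hP.conjTranspose_mul_mul_same W
    rw [h2] at h3
    have h4 := h3.diag_nonneg (i := a)
    rw [diagonal_apply_eq, Complex.zero_le_real, sub_nonneg] at h4
    calc N * l a ≤ N * (N : ℝ)⁻¹ := by gcongr
      _ = 1 := mul_inv_cancel₀ hN0.ne'
  have hsum : ∑ a, l a = 1 := by
    have := hγ.1.trace_eq_sum_eigenvalues
    rw [htr] at this
    simpa using (congrArg Complex.re this).symm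
  obtain ⟨X, w, hX, hw, hXw⟩ := exists_configurations hγ.eigenvalues_nonneg h1 hsum
  rw [hγW]
  -- An antisymmetrised product of distinct basis vectors has squared norm `1 / N!`, hence the value
  -- of `c`.
  refine isRepresentable_of_configurations .fermion hW X hw
    (c := N.factorial) (Nat.cast_nonneg _) hXw fun k B => ?_
  have hf : ((N.factorial : ℂ)) ≠ 0 := by exact_mod_cast N.factorial_ne_zero
  rw [symProj_eq_sum, Matrix.smul_mul, Matrix.sum_mul, Matrix.smul_apply, Matrix.sum_apply,
    Complex.ofReal_natCast, smul_eq_mul, mul_inv_cancel_left₀ hf, Finset.sum_eq_single 1]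
  · rw [Matrix.smul_mul, Matrix.smul_apply, Statistics.character_one, permMat_one,
      Matrix.one_mul, one_smul, kroneckerSum_apply_self]
  · intro σ _ hσ
    rw [Matrix.smul_mul, Matrix.smul_apply, permMat_mul_apply,
      kroneckerSum_comp_perm_apply B (hX k) hσ, smul_zero]
  · simp

/-- The Pauli bound is made homogeneous because `γ + δE` need not have trace one. -/
theorem isRepresentable_fermion (hN : 1 ≤ N) {γ : OneBody d} (hγ : γ.PosSemidef)
    (hP : ((N : ℂ)⁻¹ • γ.trace • (1 : OneBody d) - γ).PosSemidef) :
    IsRepresentable .fermion N γ := by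
  by_cases h0 : γ = 0
  · subst h0
    exact ⟨0, PosSemidef.zero, by simp [compress], fun i A => by simp⟩
  · have htr : γ.trace = (γ.trace.re : ℂ) :=
      Complex.ext rfl (Complex.nonneg_iff.1 hγ.trace_nonneg).2.symm
    have ht0 : 0 < γ.trace.re := by
      refine lt_of_le_of_ne (Complex.nonneg_iff.1 hγ.trace_nonneg).1 fun h => h0 ?_
      rw [← hγ.trace_eq_zero_iff, htr, ← h, Complex.ofReal_zero]
    set t := γ.trace.re with ht
    have htC : (t : ℂ) ≠ 0 := by exact_mod_cast ht0.ne'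
    have hinv : (0 : ℂ) ≤ (t : ℂ)⁻¹ := by
      rw [← Complex.ofReal_inv]
      exact Complex.zero_le_real.2 (inv_nonneg.2 ht0.le)
    have h := isRepresentable_fermion_of_trace_eq_one hN (γ := (t : ℂ)⁻¹ • γ) (hγ.smul hinv)
      (by rw [trace_smul, htr, smul_eq_mul, inv_mul_cancel₀ htC]) (by
        have := hP.smul hinv
        rw [htr, smul_sub, smul_comm, smul_comm (t : ℂ)⁻¹, smul_inv_smul₀ htC] at this
        exact this)
    have := h.smul ht0.le
    rwa [smul_inv_smul₀ htC] at this

theorem exists_isRepresentable_boson_add_smul (N : ℕ) {γ E : OneBody d} (hγ : γ.PosDef)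
    (hE : E.IsHermitian) :
    ∃ δ : ℝ, 0 < δ ∧ IsRepresentable .boson N (γ + (δ : ℂ) • E) := by
  obtain ⟨δ, hδ, h⟩ := exists_posSemidef_add_smul hγ hE
  exact ⟨δ, hδ, isRepresentable_boson N (h δ hδ.le le_rfl)⟩

/-- Both `γ` and `Tr γ / N - γ` are linear in `γ` and positive definite here, so both stay positive
under a small step along `E`. -/
theorem exists_isRepresentable_fermion_add_smul (hN : 1 ≤ N) {γ E : OneBody d} (hγ : γ.PosDef)
    (htr : γ.trace = 1) (hP : ((N : ℂ)⁻¹ • (1 : OneBody d) - γ).PosDef) (hE : E.IsHermitian) :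
    ∃ δ : ℝ, 0 < δ ∧ IsRepresentable .fermion N (γ + (δ : ℂ) • E) := by
  have htrE : star E.trace = E.trace := by
    rw [← trace_conjTranspose, hE.eq]
  have hE' : ((N : ℂ)⁻¹ • E.trace • (1 : OneBody d) - E).IsHermitian := by
    rw [Matrix.IsHermitian, conjTranspose_sub, conjTranspose_smul, conjTranspose_smul, hE.eq,
      htrE, conjTranspose_one, star_inv₀, star_natCast]
  obtain ⟨δ₁, hδ₁, h₁⟩ := exists_posSemidef_add_smul hγ hE
  obtain ⟨δ₂, hδ₂, h₂⟩ := exists_posSemidef_add_smul hP hE'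
  refine ⟨min δ₁ δ₂, lt_min hδ₁ hδ₂, isRepresentable_fermion hN
    (h₁ _ (lt_min hδ₁ hδ₂).le (min_le_left _ _)) ?_⟩
  convert h₂ _ (lt_min hδ₁ hδ₂).le (min_le_right _ _) using 1
  rw [trace_add, trace_smul, htr, smul_eq_mul]
  module

end Representability

end QuantumOT

namespace QuantumOT

open Matrix Filter Topology

/-! ### Gibbs operators and weak duality -/

section Duality

variable {N d : ℕ} {s : Statistics} {ε : ℝ} {H : ManyBody N d} {γ : OneBody d}

lemma isHermitian_dualExponent (hH : H.IsHermitian) {U : OneBody d} (hU : U.IsHermitian) :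
    ((ε : ℂ)⁻¹ • ((N : ℂ)⁻¹ • kroneckerSum N U - H)).IsHermitian := by
  rw [Matrix.IsHermitian, conjTranspose_smul, conjTranspose_sub, conjTranspose_smul, hH.eq,
    (isHermitian_kroneckerSum hU).eq, star_inv₀, star_inv₀, star_natCast, Complex.star_def,
    Complex.conj_ofReal]

lemma symProj_mul_compress (s : Statistics) (A : ManyBody N d) :
    symProj s N d * compress s A = compress s A := by
  simp only [compress, ← Matrix.mul_assoc, symProj_mul_self]

lemma compress_mul_symProj (s : Statistics) (A : ManyBody N d) :
    compress s A * symProj s N d = compress s A := by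
  simp only [compress, Matrix.mul_assoc, symProj_mul_self]

lemma sectorExp_commute (s : Statistics) {A : ManyBody N d} (hA : A.IsHermitian) :
    symProj s N d * NormedSpace.exp (compress s A) =
      NormedSpace.exp (compress s A) * symProj s N d := by
  rw [exp_eq_cfc (isHermitian_compress s hA)]
  exact (((show Commute (compress s A) (symProj s N d) from
    (compress_mul_symProj s A).trans (symProj_mul_compress s A).symm)).cfc_real Real.exp).eq.symm

lemma compress_exp_compress (s : Statistics) {A : ManyBody N d} (hA : A.IsHermitian) :
    compress s (NormedSpace.exp (compress s A)) = sectorExp s A := by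
  rw [compress, Matrix.mul_assoc, ← sectorExp_commute s hA, ← Matrix.mul_assoc, symProj_mul_self,
    sectorExp]

lemma posSemidef_sectorExp (s : Statistics) {A : ManyBody N d} (hA : A.IsHermitian) :
    (sectorExp s A).PosSemidef := by
  rw [← compress_exp_compress s hA, compress, exp_eq_cfc (isHermitian_compress s hA)]
  obtain ⟨V, -, -, -, hf⟩ := exists_spectralSum (isHermitian_compress s hA)
  rw [hf, spectralSum]
  have h : (diagonal fun i => ((Real.exp ((isHermitian_compress s hA).eigenvalues i) : ℝ) : ℂ) :
      ManyBody N d).PosSemidef :=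
    PosSemidef.diagonal fun i => Complex.zero_le_real.2 (Real.exp_pos _).le
  have := (h.mul_mul_conjTranspose_same V).mul_mul_conjTranspose_same (symProj s N d)
  rwa [(isHermitian_symProj s N d).eq] at this

lemma compress_sectorExp (s : Statistics) {A : ManyBody N d} (hA : A.IsHermitian) :
    compress s (sectorExp s A) = sectorExp s A := by
  rw [← compress_exp_compress s hA, compress_compress]

lemma posSemidef_gibbs (s : Statistics) (ε : ℝ) (hH : H.IsHermitian) {U : OneBody d}
    (hU : U.IsHermitian) : (gibbs s ε H U).PosSemidef :=
  posSemidef_sectorExp s (isHermitian_dualExponent hH hU)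

lemma compress_gibbs (s : Statistics) (ε : ℝ) (hH : H.IsHermitian) {U : OneBody d}
    (hU : U.IsHermitian) : compress s (gibbs s ε H U) = gibbs s ε H U :=
  compress_sectorExp s (isHermitian_dualExponent hH hU)

lemma continuous_gibbs (s : Statistics) (ε : ℝ) (H : ManyBody N d) :
    Continuous (gibbs s ε H) := by
  have h : Continuous fun U : OneBody d =>
      compress s ((ε : ℂ)⁻¹ • ((N : ℂ)⁻¹ • kroneckerSum N U - H)) := by
    unfold compress
    have := continuous_kroneckerSum (N := N) (d := d)
    fun_prop
  exact continuous_const.matrix_mul (continuous_matrix_exp.comp h)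

lemma continuous_dualFunctional (s : Statistics) (ε : ℝ) (H : ManyBody N d) (γ : OneBody d) :
    Continuous (dualFunctional s ε H γ) := by
  have h := continuous_gibbs s ε H
  have h1 : Continuous fun U : OneBody d => (U * γ).trace.re :=
    Complex.continuous_re.comp (continuous_id.matrix_mul continuous_const).matrix_trace
  have h2 : Continuous fun U : OneBody d => (gibbs s ε H U).trace.re :=
    Complex.continuous_re.comp h.matrix_trace
  unfold dualFunctional
  fun_prop

/-- Gibbs' variational principle on the symmetric or antisymmetric subspace. -/
theorem gibbs_variational (s : Statistics) (hε : 0 < ε) (hH : H.IsHermitian)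
    {U : OneBody d} (hU : U.IsHermitian) {Γ : ManyBody N d} (hΓ : Γ.PosSemidef)
    (hΓs : compress s Γ = Γ) :
    (Γ * kroneckerSum N U).trace.re / N - ε * (gibbs s ε H U).trace.re + ε * Γ.trace.re ≤
        primalEnergy ε H Γ ∧
      ((Γ * kroneckerSum N U).trace.re / N - ε * (gibbs s ε H U).trace.re + ε * Γ.trace.re =
        primalEnergy ε H Γ ↔ Γ = gibbs s ε H U) := by
  obtain ⟨h1, h2⟩ := klein_inequality (isHermitian_symProj s N d) (symProj_mul_self s N d)
    (isHermitian_compress s (isHermitian_dualExponent (ε := ε) hH hU))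
    (compress_compress s _) hΓ hΓs
  rw [trace_compress_mul s _ hΓs] at h1 h2
  have h3 : (((ε : ℂ)⁻¹ • ((N : ℂ)⁻¹ • kroneckerSum N U - H)) * Γ).trace.re =
      ε⁻¹ * ((Γ * kroneckerSum N U).trace.re / N - (H * Γ).trace.re) := by
    rw [Matrix.smul_mul, Matrix.sub_mul, Matrix.smul_mul, trace_smul, trace_sub, trace_smul,
      Matrix.trace_mul_comm (kroneckerSum N U), smul_eq_mul, smul_eq_mul, ← Complex.ofReal_inv,
      Complex.re_ofReal_mul, Complex.sub_re, ← Complex.ofReal_natCast, ← Complex.ofReal_inv,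
      Complex.re_ofReal_mul, div_eq_inv_mul]
  -- The duality gap is exactly `ε` times Klein's expression.
  have h4 : primalEnergy ε H Γ - ((Γ * kroneckerSum N U).trace.re / N -
      ε * (gibbs s ε H U).trace.re + ε * Γ.trace.re) =
      ε * ((Γ * cfc Real.log Γ).trace.re -
        (((ε : ℂ)⁻¹ • ((N : ℂ)⁻¹ • kroneckerSum N U - H)) * Γ).trace.re +
        (gibbs s ε H U).trace.re - Γ.trace.re) := by
    rw [h3, primalEnergy]
    field_simp
    ring
  refine ⟨sub_nonneg.1 (h4 ▸ mul_nonneg hε.le h1), ?_⟩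
  rw [eq_comm, ← sub_eq_zero, h4, mul_eq_zero, or_iff_right hε.ne']
  exact h2

lemma primalEnergy_gibbs (s : Statistics) (hε : 0 < ε) (hH : H.IsHermitian)
    {U : OneBody d} (hU : U.IsHermitian) :
    primalEnergy ε H (gibbs s ε H U) = (gibbs s ε H U * kroneckerSum N U).trace.re / N := by
  rw [← (gibbs_variational s hε hH hU (posSemidef_gibbs s ε hH hU)
    (compress_gibbs s ε hH hU)).2.2 rfl]
  ring

/-- The trace of the Gibbs state is convex in the potential. -/
lemma gibbs_trace_subgradient (s : Statistics) (hε : 0 < ε) (hH : H.IsHermitian)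
    {U V : OneBody d} (hU : U.IsHermitian) (hV : V.IsHermitian) :
    (gibbs s ε H V * kroneckerSum N (U - V)).trace.re / N ≤
      ε * (gibbs s ε H U).trace.re - ε * (gibbs s ε H V).trace.re := by
  have h := (gibbs_variational s hε hH hU (posSemidef_gibbs s ε hH hV)
    (compress_gibbs s ε hH hV)).1
  rw [primalEnergy_gibbs s hε hH hV] at h
  rw [kroneckerSum_sub, Matrix.mul_sub, trace_sub, Complex.sub_re, sub_div]
  linarith

lemma HasMarginals.trace_kroneckerSum_re {Γ : ManyBody N d} (hN : 1 ≤ N)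
    (h : HasMarginals Γ γ) (U : OneBody d) :
    (Γ * kroneckerSum N U).trace.re / N = (U * γ).trace.re := by
  have hN0 : (N : ℝ) ≠ 0 := by
    exact_mod_cast (Nat.one_le_iff_ne_zero.1 hN)
  rw [h.trace_kroneckerSum, Matrix.trace_mul_comm, ← Complex.ofReal_natCast,
    Complex.re_ofReal_mul, mul_div_cancel_left₀ _ hN0]

/-- Weak duality, with its case of equality. -/
lemma dualFunctional_le_primalEnergy (hN : 1 ≤ N) (hε : 0 < ε) (hH : H.IsHermitian)
    {U : OneBody d} (hU : U.IsHermitian) {Γ : ManyBody N d} (hΓ : IsAdmissible s γ Γ) :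
    dualFunctional s ε H γ U ≤ primalEnergy ε H Γ ∧
      (dualFunctional s ε H γ U = primalEnergy ε H Γ ↔ Γ = gibbs s ε H U) := by
  have h := gibbs_variational s hε hH hU hΓ.1.1.1 hΓ.1.2
  rwa [hΓ.2.trace_kroneckerSum_re hN, hΓ.1.1.2, Complex.one_re, mul_one] at h

/-- Variations along Hermitian `W` see only real parts; `A + Aᴴ` extends the identity to all `A`,
and `Complex.I • A` then supplies the imaginary parts. -/
lemma hasMarginals_of_hermitian {Γ : ManyBody N d} (hΓ : Γ.IsHermitian)
    (hΓs : compress s Γ = Γ) (hγ : γ.IsHermitian)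
    (h : ∀ W : OneBody d, W.IsHermitian →
      (Γ * kroneckerSum N W).trace.re = N * (γ * W).trace.re) : HasMarginals Γ γ := by
  refine hasMarginals_of_trace_kroneckerSum s hΓs fun A => ?_
  have hre : ∀ A : OneBody d,
      (Γ * kroneckerSum N A).trace.re = N * (γ * A).trace.re := by
    intro A
    have hk : kroneckerSum N Aᴴ = (kroneckerSum N A)ᴴ := by
      rw [kroneckerSum, kroneckerSum, conjTranspose_sum]
      simp only [siteOp_conjTranspose]
    have h1 : (Γ * kroneckerSum N Aᴴ).trace.re = (Γ * kroneckerSum N A).trace.re := by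
      rw [hk, ← hΓ.eq, ← conjTranspose_mul, trace_conjTranspose, Matrix.trace_mul_comm, hΓ.eq]
      exact Complex.conj_re _
    have h2 : (γ * Aᴴ).trace.re = (γ * A).trace.re := by
      rw [← hγ.eq, ← conjTranspose_mul, trace_conjTranspose, Matrix.trace_mul_comm, hγ.eq]
      exact Complex.conj_re _
    have h3 := h (A + Aᴴ) (isHermitian_add_transpose_self A)
    rw [kroneckerSum_add, Matrix.mul_add, Matrix.mul_add, trace_add, trace_add, Complex.add_re,
      Complex.add_re, h1, h2] at h3
    linarith
  apply Complex.ext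
  · rw [hre, ← Complex.ofReal_natCast, Complex.re_ofReal_mul]
  · have h1 := hre (Complex.I • A)
    rw [kroneckerSum_smul, Matrix.mul_smul, Matrix.mul_smul, trace_smul, trace_smul, smul_eq_mul,
      smul_eq_mul, Complex.I_mul_re, Complex.I_mul_re] at h1
    rw [← Complex.ofReal_natCast, Complex.im_ofReal_mul]
    linarith

/-! ### Penalised dual problem and strong duality -/

/-- The dual functional with a quadratic penalty. -/
noncomputable def penalisedDual (s : Statistics) (ε : ℝ) (H : ManyBody N d) (γ : OneBody d)
    (η : ℝ) (U : OneBody d) : ℝ :=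
  dualFunctional s ε H γ U - η / 2 * (U * U).trace.re

lemma continuous_penalisedDual (s : Statistics) (ε : ℝ) (H : ManyBody N d) (γ : OneBody d)
    (η : ℝ) : Continuous (penalisedDual s ε H γ η) := by
  have h1 : Continuous fun U : OneBody d => (U * U).trace.re :=
    Complex.continuous_re.comp (continuous_id.matrix_mul continuous_id).matrix_trace
  exact (continuous_dualFunctional s ε H γ).sub (continuous_const.mul h1)

/-- The Euler–Lagrange equation of the penalised dual problem. -/
theorem euler_lagrange (hε : 0 < ε) (hH : H.IsHermitian) {η : ℝ} {U : OneBody d}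
    (hU : U.IsHermitian)
    (hmax : ∀ V : OneBody d, V.IsHermitian →
      penalisedDual s ε H γ η V ≤ penalisedDual s ε H γ η U)
    {W : OneBody d} (hW : W.IsHermitian) :
    (γ * W).trace.re - (gibbs s ε H U * kroneckerSum N W).trace.re / N =
      η * (U * W).trace.re := by
  have key : ∀ W : OneBody d, W.IsHermitian →
      (γ * W).trace.re - (gibbs s ε H U * kroneckerSum N W).trace.re / N ≤
        η * (U * W).trace.re := by
    intro W hW
    -- No derivative of the exponential is needed: maximality and the subgradient inequality at `U +
    -- tW` give `t * F t ≤ 0`, and continuity lets `t` decrease to `0`.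
    set F : ℝ → ℝ := fun t => (γ * W).trace.re -
      (gibbs s ε H (U + (t : ℂ) • W) * kroneckerSum N W).trace.re / N -
      η * (U * W).trace.re - η / 2 * t * (W * W).trace.re with hF
    have hcont : Continuous F := by
      have h1 : Continuous fun t : ℝ => gibbs s ε H (U + (t : ℂ) • W) :=
        (continuous_gibbs s ε H).comp (by fun_prop)
      have h2 : Continuous fun t : ℝ =>
          (gibbs s ε H (U + (t : ℂ) • W) * kroneckerSum N W).trace.re :=
        Complex.continuous_re.comp (h1.matrix_mul continuous_const).matrix_trace
      fun_prop
    have hle : ∀ t : ℝ, 0 < t → F t ≤ 0 := by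
      intro t ht
      have htW : ((t : ℂ) • W).IsHermitian := by
        rw [Matrix.IsHermitian, conjTranspose_smul, hW.eq, Complex.star_def, Complex.conj_ofReal]
      have hV : (U + (t : ℂ) • W).IsHermitian := hU.add htW
      have h1 := hmax _ hV
      have h2 := gibbs_trace_subgradient s hε hH hU hV
      rw [show U - (U + (t : ℂ) • W) = ((-t : ℝ) : ℂ) • W by push_cast; module,
        kroneckerSum_smul, Matrix.mul_smul, trace_smul, smul_eq_mul, Complex.re_ofReal_mul] at h2
      have h3 : ((U + (t : ℂ) • W) * γ).trace.re = (U * γ).trace.re + t * (γ * W).trace.re := by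
        rw [Matrix.add_mul, trace_add, Complex.add_re, Matrix.smul_mul, trace_smul, smul_eq_mul,
          Complex.re_ofReal_mul, Matrix.trace_mul_comm W]
      have h4 : ((U + (t : ℂ) • W) * (U + (t : ℂ) • W)).trace.re = (U * U).trace.re +
          2 * t * (U * W).trace.re + t * t * (W * W).trace.re := by
        simp only [Matrix.add_mul, Matrix.mul_add, trace_add, Complex.add_re, Matrix.smul_mul,
          Matrix.mul_smul, trace_smul, smul_eq_mul, Complex.re_ofReal_mul,
          Matrix.trace_mul_comm W U]
        ring
      simp only [penalisedDual, dualFunctional, h3, h4] at h1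
      have h5 : t * F t ≤ 0 := by
        simp only [hF]
        rw [mul_div_assoc] at h2
        linarith
      exact nonpos_of_mul_nonpos_right h5 ht
    have h0 : F 0 ≤ 0 := by
      have hlim : Tendsto F (𝓝[>] 0) (𝓝 (F 0)) := hcont.continuousWithinAt
      exact le_of_tendsto hlim (eventually_nhdsWithin_of_forall hle)
    simp only [hF, Complex.ofReal_zero, zero_smul, add_zero, mul_zero, zero_mul, sub_zero] at h0
    linarith
  refine le_antisymm (key W hW) ?_
  have h := key (-W) hW.neg
  rw [show -W = (-1 : ℂ) • W by simp, kroneckerSum_smul] at h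
  simp only [Matrix.mul_smul, trace_smul, smul_eq_mul, neg_mul, one_mul, Complex.neg_re] at h
  rw [neg_div] at h
  linarith

open scoped Matrix.Norms.Elementwise in
lemma exists_isMaxOn_hermitian {f : OneBody d → ℝ} (hf : Continuous f) {R : ℝ} (hR : 0 ≤ R)
    (hb : ∀ U : OneBody d, U.IsHermitian → f 0 ≤ f U → ∀ i j, ‖U i j‖ ≤ R) :
    ∃ U : OneBody d, U.IsHermitian ∧ ∀ V : OneBody d, V.IsHermitian → f V ≤ f U := by
  have hclosed : IsClosed {U : OneBody d | U.IsHermitian} :=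
    isClosed_eq (by fun_prop) continuous_id
  have hcomp : IsCompact ({U : OneBody d | U.IsHermitian} ∩ Metric.closedBall 0 R) := by
    have : ProperSpace (OneBody d) := FiniteDimensional.proper ℂ _
    exact (isCompact_closedBall (0 : OneBody d) R).inter_left hclosed
  have h0 : (0 : OneBody d) ∈ {U : OneBody d | U.IsHermitian} ∩ Metric.closedBall 0 R :=
    ⟨isHermitian_zero, by simpa using hR⟩
  obtain ⟨U, hU, hmax⟩ := hcomp.exists_isMaxOn ⟨0, h0⟩ hf.continuousOn
  refine ⟨U, hU.1, fun V hV => ?_⟩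
  by_cases h : f 0 ≤ f V
  · refine hmax ⟨hV, ?_⟩
    rw [mem_closedBall_zero_iff, Matrix.norm_le_iff hR]
    exact hb V hV h
  · exact (not_le.1 h).le.trans (hmax h0)

lemma normSq_le_trace_mul_self {U : OneBody d} (hU : U.IsHermitian) (i j : Fin d) :
    Complex.normSq (U i j) ≤ (U * U).trace.re := by
  have h : (U * U).trace.re = ∑ i, ∑ j, Complex.normSq (U i j) := by
    have : (U * U).trace = (U * Uᴴ).trace := by rw [hU.eq]
    rw [this, Matrix.trace, Complex.re_sum]
    refine Finset.sum_congr rfl fun i _ => ?_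
    rw [diag_apply, Matrix.mul_apply, Complex.re_sum]
    refine Finset.sum_congr rfl fun j _ => ?_
    rw [conjTranspose_apply, Complex.star_def, Complex.mul_conj, Complex.ofReal_re]
  rw [h]
  refine le_trans ?_ (Finset.single_le_sum
    (f := fun i => ∑ j, Complex.normSq (U i j))
    (fun i _ => Finset.sum_nonneg fun j _ => Complex.normSq_nonneg _) (Finset.mem_univ i))
  exact Finset.single_le_sum (f := fun j => Complex.normSq (U i j))
    (fun j _ => Complex.normSq_nonneg _) (Finset.mem_univ j)

/-- With the dual bounded by `M`, the penalty forces `η/2 Tr U² ≤ M - D(0)` on the superlevel set of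
`0`, where `D` is the dual functional. -/
lemma exists_penalisedDual_maximiser {M : ℝ}
    (hM : ∀ U : OneBody d, U.IsHermitian → dualFunctional s ε H γ U ≤ M) {η : ℝ} (hη : 0 < η) :
    ∃ U : OneBody d, U.IsHermitian ∧ ∀ V : OneBody d, V.IsHermitian →
      penalisedDual s ε H γ η V ≤ penalisedDual s ε H γ η U := by
  refine exists_isMaxOn_hermitian (continuous_penalisedDual s ε H γ η)
    (Real.sqrt_nonneg (2 * (M - dualFunctional s ε H γ 0) / η)) fun U hU h i j => ?_
  refine Real.le_sqrt_of_sq_le ?_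
  rw [← Complex.normSq_eq_norm_sq, le_div_iff₀ hη]
  have h1 := normSq_le_trace_mul_self hU i j
  have h2 := hM U hU
  simp only [penalisedDual, trace_zero, Complex.zero_re, mul_zero,
    sub_zero] at h
  nlinarith

lemma primalEnergy_continuousOn (ε : ℝ) (H : ManyBody N d) (K : ℝ) :
    ContinuousOn (primalEnergy ε H)
      {Γ : ManyBody N d | Γ.PosSemidef ∧ Γ.trace.re ≤ K} := by
  have h1 : Continuous fun Γ : ManyBody N d => (H * Γ).trace.re :=
    Complex.continuous_re.comp (continuous_const.matrix_mul continuous_id).matrix_trace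
  have h2 : Continuous fun Γ : ManyBody N d => Γ.trace.re :=
    Complex.continuous_re.comp continuous_id.matrix_trace
  exact h1.continuousOn.add
    ((h2.comp_continuousOn (continuousOn_mul_cfc_log K)).const_smul ε)

/-- Existence of a competitor whose energy is a lower bound for the dual value. -/
theorem exists_admissible_le_of_forall_le (hN : 1 ≤ N) (hε : 0 < ε) (hH : H.IsHermitian)
    (hγ : IsDensity γ) {Γ₁ : ManyBody N d} (hΓ₁ : IsAdmissible s γ Γ₁) :
    ∃ Γ : ManyBody N d, IsAdmissible s γ Γ ∧
      ∀ b : ℝ, (∀ U : OneBody d, U.IsHermitian → dualFunctional s ε H γ U ≤ b) →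
        primalEnergy ε H Γ ≤ b := by
  have hN0 : (0 : ℝ) < N := by exact_mod_cast hN
  set M := primalEnergy ε H Γ₁ with hM
  have hbound : ∀ U : OneBody d, U.IsHermitian → dualFunctional s ε H γ U ≤ M :=
    fun U hU => (dualFunctional_le_primalEnergy hN hε hH hU hΓ₁).1
  set η : ℕ → ℝ := fun n => 1 / ((n : ℝ) + 1) with hη
  have hη0 : ∀ n, 0 < η n := fun n => by positivity
  have hηlim : Tendsto η atTop (𝓝 0) := tendsto_one_div_add_atTop_nhds_zero_nat
  choose U hU hmax using fun n => exists_penalisedDual_maximiser hbound (hη0 n)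
  set G : ℕ → ManyBody N d := fun n => gibbs s ε H (U n) with hG
  set E : ℕ → OneBody d := fun n => (η n : ℂ) • U n with hE
  set C := 2 * (M - dualFunctional s ε H γ 0) with hC
  have hT : ∀ n, η n * (U n * U n).trace.re ≤ C := by
    intro n
    have h := hmax n 0 isHermitian_zero
    have h2 := hbound _ (hU n)
    simp only [penalisedDual, trace_zero, Complex.zero_re, mul_zero,
      sub_zero] at h
    linarith
  -- The potentials `U n` may diverge, but `|E_ij|² ≤ η² Tr U² ≤ η C`.
  have hElim : Tendsto E atTop (𝓝 0) := by
    refine tendsto_pi_nhds.2 fun i => tendsto_pi_nhds.2 fun j => ?_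
    have hb : Tendsto (fun n => Real.sqrt (η n * C)) atTop (𝓝 0) := by
      have := (Real.continuous_sqrt.tendsto 0).comp
        (by simpa using hηlim.mul_const C : Tendsto (fun n => η n * C) atTop (𝓝 0))
      simpa [Function.comp_def] using this
    refine squeeze_zero_norm (fun n => Real.le_sqrt_of_sq_le ?_) hb
    have h1 := normSq_le_trace_mul_self (hU n) i j
    have h2 := hT n
    have h3 := (hη0 n).le
    rw [← Complex.normSq_eq_norm_sq, show E n i j = (η n : ℂ) * U n i j from rfl,
      Complex.normSq_mul, Complex.normSq_ofReal, mul_assoc]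
    exact mul_le_mul_of_nonneg_left ((mul_le_mul_of_nonneg_left h1 h3).trans h2) h3
  have hEL : ∀ n (W : OneBody d), W.IsHermitian →
      (γ * W).trace.re - (G n * kroneckerSum N W).trace.re / N = (E n * W).trace.re := by
    intro n W hW
    rw [euler_lagrange hε hH (hU n) (hmax n) hW, hE, Matrix.smul_mul, trace_smul, smul_eq_mul,
      Complex.re_ofReal_mul]
  have htr : ∀ n, (G n).trace.re = 1 - (E n).trace.re := by
    intro n
    have h := hEL n 1 isHermitian_one
    rw [kroneckerSum_one, Matrix.mul_smul, Matrix.mul_one, Matrix.mul_one, Matrix.mul_one,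
      trace_smul, smul_eq_mul, ← Complex.ofReal_natCast, Complex.re_ofReal_mul,
      mul_div_cancel_left₀ _ hN0.ne', hγ.2, Complex.one_re] at h
    linarith
  have hre : Continuous fun A : OneBody d => A.trace.re :=
    Complex.continuous_re.comp continuous_id.matrix_trace
  have htrlim : Tendsto (fun n => (G n).trace.re) atTop (𝓝 1) := by
    simp only [htr]
    have := (hre.tendsto 0).comp hElim
    simpa using this.const_sub 1
  -- The traces tend to `1`; any bound above `1` would do in place of `2`.
  have hmem : ∀ᶠ n in atTop,
      G n ∈ {Γ : ManyBody N d | Γ.PosSemidef ∧ Γ.trace.re ≤ 2} := by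
    filter_upwards [htrlim.eventually (eventually_le_nhds (by norm_num : (1 : ℝ) < 2))] with n hn
    exact ⟨posSemidef_gibbs s ε hH (hU n), hn⟩
  have : FirstCountableTopology (ManyBody N d) :=
    inferInstanceAs (FirstCountableTopology ((Fin N → Fin d) → (Fin N → Fin d) → ℂ))
  obtain ⟨Γ, hΓ, φ, hφ, hlim⟩ := (isCompact_posSemidef_trace_le 2).tendsto_subseq' hmem.frequently
  have hφ' := hφ.tendsto_atTop
  have hre' : Continuous fun A : ManyBody N d => A.trace.re :=
    Complex.continuous_re.comp continuous_id.matrix_trace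
  have hcomp : compress s Γ = Γ := by
    have hc : Continuous fun A : ManyBody N d => compress s A := by
      unfold compress
      fun_prop
    refine tendsto_nhds_unique ((hc.tendsto Γ).comp hlim) (hlim.congr fun n => ?_)
    exact (compress_gibbs s ε hH (hU _)).symm
  have hmarg : HasMarginals Γ γ := by
    refine hasMarginals_of_hermitian hΓ.1.1 hcomp hγ.1.1 fun W hW => ?_
    have hc : Continuous fun A : ManyBody N d =>
        (γ * W).trace.re - (A * kroneckerSum N W).trace.re / N :=
      continuous_const.sub ((Complex.continuous_re.comp
        (continuous_id.matrix_mul continuous_const).matrix_trace).div_const _)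
    have hc' : Continuous fun A : OneBody d => (A * W).trace.re :=
      Complex.continuous_re.comp (continuous_id.matrix_mul continuous_const).matrix_trace
    have h1 := (hc.tendsto Γ).comp hlim
    have h2 := (hc'.tendsto 0).comp (hElim.comp hφ')
    have h3 := tendsto_nhds_unique h1 (h2.congr fun n => (hEL _ W hW).symm)
    rw [Matrix.zero_mul, trace_zero, Complex.zero_re, sub_eq_zero, eq_div_iff hN0.ne'] at h3
    linarith
  refine ⟨Γ, ⟨⟨⟨hΓ.1, ?_⟩, hcomp⟩, hmarg⟩, fun b hb => ?_⟩
  · rw [hmarg.trace_eq hN, hγ.2]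
  · have h1 : Tendsto (fun n => primalEnergy ε H (G (φ n))) atTop (𝓝 (primalEnergy ε H Γ)) :=
      ((primalEnergy_continuousOn ε H 2) Γ hΓ).tendsto.comp
        (tendsto_nhdsWithin_iff.2 ⟨hlim, hφ'.eventually hmem⟩)
    have h2 : Tendsto (fun n => b + ε * ((G (φ n)).trace.re - 1)) atTop (𝓝 b) := by
      have := (((htrlim.comp hφ').sub_const 1).const_mul ε).const_add b
      simpa using this
    -- The energy of `G` is `Tr γU - Tr EU ≤ Tr γU`, which is the dual value at `U` plus `ε (Tr G -
    -- 1)`.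
    refine le_of_tendsto_of_tendsto' h1 h2 fun n => ?_
    have h3 := hEL (φ n) (U (φ n)) (hU _)
    have h4 := hb _ (hU (φ n))
    have h5 : 0 ≤ (E (φ n) * U (φ n)).trace.re := by
      rw [hE, Matrix.smul_mul, trace_smul, smul_eq_mul, Complex.re_ofReal_mul]
      refine mul_nonneg (hη0 _).le ?_
      have h := (posSemidef_conjTranspose_mul_self (U (φ n))).trace_nonneg
      rw [(hU (φ n)).eq] at h
      exact (Complex.nonneg_iff.1 h).1
    rw [hG, primalEnergy_gibbs s hε hH (hU _)]
    rw [dualFunctional, Matrix.trace_mul_comm] at h4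
    simp only [hG] at h3 ⊢
    linarith

theorem dualityHolds_of_admissible (hN : 1 ≤ N) (hε : 0 < ε) (hH : H.IsHermitian)
    (hγ : IsDensity γ) {Γ₁ : ManyBody N d} (hΓ₁ : IsAdmissible s γ Γ₁) :
    DualityHolds s ε H γ := by
  obtain ⟨Γ, hΓ, hle⟩ := exists_admissible_le_of_forall_le hN hε hH hγ hΓ₁
  have hpΓ : primalValue s ε H γ ≤ (primalEnergy ε H Γ : EReal) := iInf₂_le Γ hΓ
  have hweak : dualValue s ε H γ ≤ primalValue s ε H γ := by
    refine iSup₂_le fun U hU => le_iInf₂ fun Γ' hΓ' => ?_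
    exact_mod_cast (dualFunctional_le_primalEnergy hN hε hH hU hΓ').1
  have hΓd : (primalEnergy ε H Γ : EReal) ≤ dualValue s ε H γ := by
    by_contra! hlt
    -- A real bound strictly in between avoids assuming that the dual supremum is finite.
    obtain ⟨b, hb1, hb2⟩ := EReal.lt_iff_exists_real_btwn.1 hlt
    refine absurd (hle b fun U hU => ?_) (not_le.2 (by exact_mod_cast hb2))
    have h : (dualFunctional s ε H γ U : EReal) ≤ dualValue s ε H γ :=
      le_iSup₂ (f := fun (U : OneBody d) (_ : U.IsHermitian) =>
        (dualFunctional s ε H γ U : EReal)) U hU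
    exact_mod_cast h.trans hb1.le
  exact ⟨le_antisymm (hpΓ.trans hΓd) hweak, _, le_antisymm hpΓ (hΓd.trans hweak)⟩

/-! ### Existence and uniqueness of optimisers in the interior -/

/-- The dual superlevel set is bounded if `γ` is in the interior of the representable cone. -/
lemma exists_dualFunctional_maximiser (hN : 1 ≤ N) (hε : 0 < ε) (hH : H.IsHermitian)
    (hint : ∀ E : OneBody d, E.IsHermitian →
      ∃ δ : ℝ, 0 < δ ∧ IsRepresentable s N (γ + (δ : ℂ) • E)) :
    ∃ U : OneBody d, IsDualMaximiser s ε H γ U := by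
  -- If `Γ` represents `γ + δ(A + Aᴴ)`, the variational principle bounds the dual functional plus
  -- `2δ Re Tr UA` independently of `U`.
  have hdir : ∀ A : OneBody d, ∃ C : ℝ, ∀ U : OneBody d, U.IsHermitian →
      dualFunctional s ε H γ 0 ≤ dualFunctional s ε H γ U → (U * A).trace.re ≤ C := by
    intro A
    obtain ⟨δ, hδ, Γ, hΓ, hΓs, hΓm⟩ := hint (A + Aᴴ) (isHermitian_add_transpose_self A)
    refine ⟨(primalEnergy ε H Γ - ε * Γ.trace.re + ε - dualFunctional s ε H γ 0) / (2 * δ),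
      fun U hU h => ?_⟩
    rw [le_div_iff₀ (by positivity)]
    have h1 := (gibbs_variational s hε hH hU hΓ hΓs).1
    have h2 : (U * Aᴴ).trace.re = (U * A).trace.re := by
      rw [← hU.eq, ← conjTranspose_mul, trace_conjTranspose, Matrix.trace_mul_comm, hU.eq]
      exact Complex.conj_re _
    rw [hΓm.trace_kroneckerSum_re hN, Matrix.mul_add, trace_add, Complex.add_re, Matrix.mul_smul,
      trace_smul, smul_eq_mul, Complex.re_ofReal_mul, Matrix.mul_add, trace_add, Complex.add_re,
      h2] at h1
    rw [dualFunctional.eq_def s ε H γ U] at h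
    linarith
  choose C hC using hdir
  -- The directions `±1` and `±i` at each matrix unit bound the real and imaginary parts of each
  -- entry.
  set R : ℝ := ∑ i : Fin d, ∑ j : Fin d, (|C (single j i 1)| + |C (single j i (-1))| +
    (|C (single j i Complex.I)| + |C (single j i (-Complex.I))|)) with hR
  have hR0 : 0 ≤ R := Finset.sum_nonneg fun i _ => Finset.sum_nonneg fun j _ => by positivity
  refine exists_isMaxOn_hermitian (continuous_dualFunctional s ε H γ) hR0 fun U hU h i j => ?_
  have hentry : ∀ c : ℂ, (c * U i j).re ≤ |C (single j i c)| := by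
    intro c
    have h1 := hC (single j i c) U hU h
    rw [Matrix.trace_mul_comm, Matrix.trace_single_mul] at h1
    exact h1.trans (le_abs_self _)
  have hre : |(U i j).re| ≤ |C (single j i 1)| + |C (single j i (-1))| := by
    have h1 := hentry 1
    have h2 := hentry (-1)
    simp only [one_mul, neg_mul, Complex.neg_re] at h1 h2
    exact abs_le.2 ⟨by linarith [abs_nonneg (C (single j i 1))],
      by linarith [abs_nonneg (C (single j i (-1)))]⟩
  have him : |(U i j).im| ≤ |C (single j i Complex.I)| + |C (single j i (-Complex.I))| := by
    have h1 := hentry Complex.I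
    have h2 := hentry (-Complex.I)
    simp only [neg_mul, Complex.neg_re, Complex.I_mul_re] at h1 h2
    exact abs_le.2 ⟨by linarith [abs_nonneg (C (single j i (-Complex.I)))],
      by linarith [abs_nonneg (C (single j i (Complex.I)))]⟩
  refine (Complex.norm_le_abs_re_add_abs_im _).trans ((add_le_add hre him).trans ?_)
  refine le_trans ?_ (Finset.single_le_sum
    (f := fun i => ∑ j : Fin d, (|C (single j i 1)| + |C (single j i (-1))| +
      (|C (single j i Complex.I)| + |C (single j i (-Complex.I))|)))
    (fun i _ => Finset.sum_nonneg fun j _ => by positivity) (Finset.mem_univ i))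
  exact Finset.single_le_sum
    (f := fun j => |C (single j i 1)| + |C (single j i (-1))| +
      (|C (single j i Complex.I)| + |C (single j i (-Complex.I))|))
    (fun j _ => by positivity) (Finset.mem_univ j)

lemma exp_injective_of_isHermitian {ι : Type*} [Fintype ι] [DecidableEq ι] {A B : Matrix ι ι ℂ}
    (hA : A.IsHermitian) (hB : B.IsHermitian) (h : NormedSpace.exp A = NormedSpace.exp B) :
    A = B := by
  have hlog : ∀ {A : Matrix ι ι ℂ}, A.IsHermitian → cfc Real.log (NormedSpace.exp A) = A := by
    intro A hA
    have hsa : IsSelfAdjoint A := hA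
    have hfin : (spectrum ℝ A).Finite := Matrix.finite_real_spectrum
    rw [exp_eq_cfc hA, ← cfc_comp Real.log Real.exp A hsa
      ((hfin.image Real.exp).continuousOn _) (hfin.continuousOn _)]
    simp only [Function.comp_def, Real.log_exp]
    exact cfc_id' ℝ A hsa
  rw [← hlog hA, h, hlog hB]

/-- The compressed operator vanishes off the sector, so its exponential is the identity there. The
full exponential, and hence the exponent, can be recovered from the sector part. -/
lemma exp_compress_eq (s : Statistics) {A : ManyBody N d} (hA : A.IsHermitian) :
    NormedSpace.exp (compress s A) = sectorExp s A + (1 - symProj s N d) := by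
  have h : (1 - symProj s N d) * NormedSpace.exp (compress s A) = 1 - symProj s N d := by
    obtain ⟨V, hV, hV', hAV, hf⟩ := exists_spectralSum (isHermitian_compress s hA)
    rw [exp_eq_cfc (isHermitian_compress s hA)]
    set a := (isHermitian_compress s hA).eigenvalues
    have h0 : (1 - symProj s N d) * compress s A = 0 := by
      rw [Matrix.sub_mul, Matrix.one_mul, symProj_mul_compress, sub_self]
    set Q := 1 - symProj s N d
    have hentry : ∀ i j, (Vᴴ * Q * V) i j * a j = 0 := by
      intro i j
      rw [← mul_spectralSum_mul_apply hV', ← hAV, h0]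
      simp
    have h3 : Vᴴ * (Q * cfc Real.exp (compress s A)) * V = Vᴴ * Q * V := by
      ext i j
      rw [hf, mul_spectralSum_mul_apply hV']
      rcases mul_eq_zero.1 (hentry i j) with h | h
      · rw [h, zero_mul]
      · rw [Complex.ofReal_eq_zero.1 h, Real.exp_zero, Complex.ofReal_one, mul_one]
    have h4 : ∀ X : ManyBody N d, V * (Vᴴ * X * V) * Vᴴ = X := by
      intro X
      rw [show V * (Vᴴ * X * V) * Vᴴ = (V * Vᴴ) * X * (V * Vᴴ) by
        simp only [Matrix.mul_assoc], hV, Matrix.one_mul, Matrix.mul_one]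
    rw [← h4 (Q * _), h3, h4]
  rw [Matrix.sub_mul, Matrix.one_mul, ← sectorExp, sub_eq_iff_eq_add] at h
  rw [h, add_comm]

lemma compress_kroneckerSum_eq_of_gibbs_eq (hN : 1 ≤ N) (hε : 0 < ε) (hH : H.IsHermitian)
    {U V : OneBody d} (hU : U.IsHermitian) (hV : V.IsHermitian)
    (h : gibbs s ε H U = gibbs s ε H V) :
    compress s (kroneckerSum N (U - V)) = 0 := by
  have hAU := isHermitian_dualExponent (ε := ε) hH hU
  have hAV := isHermitian_dualExponent (ε := ε) hH hV
  have h1 : compress s ((ε : ℂ)⁻¹ • ((N : ℂ)⁻¹ • kroneckerSum N U - H)) =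
      compress s ((ε : ℂ)⁻¹ • ((N : ℂ)⁻¹ • kroneckerSum N V - H)) := by
    refine exp_injective_of_isHermitian (isHermitian_compress s hAU)
      (isHermitian_compress s hAV) ?_
    rw [exp_compress_eq s hAU, exp_compress_eq s hAV]
    exact congrArg (· + _) h
  have hsub : ∀ A B : ManyBody N d, compress s (A - B) = compress s A - compress s B := by
    intro A B
    rw [compress, Matrix.mul_sub, Matrix.sub_mul]
    rfl
  have hsmul : ∀ (c : ℂ) (A : ManyBody N d), compress s (c • A) = c • compress s A := by
    intro c A
    rw [compress, Matrix.mul_smul, Matrix.smul_mul]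
    rfl
  have hε' : (ε : ℂ)⁻¹ ≠ 0 := inv_ne_zero (by exact_mod_cast hε.ne')
  have hN' : (N : ℂ)⁻¹ ≠ 0 := inv_ne_zero (by exact_mod_cast (Nat.one_le_iff_ne_zero.1 hN))
  rw [← sub_eq_zero, ← hsub, ← smul_sub, hsmul, smul_eq_zero_iff_right hε', sub_sub_sub_cancel_right,
    ← smul_sub, hsmul, smul_eq_zero_iff_right hN', ← kroneckerSum_sub] at h1
  exact h1

/-- The marginals of the Gibbs states determine the potential. -/
lemma eq_of_gibbs_eq (hN : 1 ≤ N) (hε : 0 < ε) (hH : H.IsHermitian)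
    (hint : ∀ E : OneBody d, E.IsHermitian →
      ∃ δ : ℝ, 0 < δ ∧ IsRepresentable s N (γ + (δ : ℂ) • E))
    {U V : OneBody d} (hU : U.IsHermitian) (hV : V.IsHermitian)
    (h : gibbs s ε H U = gibbs s ε H V) : U = V := by
  have h0 := compress_kroneckerSum_eq_of_gibbs_eq hN hε hH hU hV h
  have hW : (U - V).IsHermitian := hU.sub hV
  set W := U - V with hWdef
  -- The compressed Kronecker sum of `W` vanishes, so `W` pairs to zero with every representable
  -- matrix. Directions `0` and `W` then leave `δ Tr W² = 0`.
  have hzero : ∀ γ' : OneBody d, IsRepresentable s N γ' → (W * γ').trace.re = 0 := by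
    rintro γ' ⟨Γ, -, hΓs, hΓm⟩
    rw [← hΓm.trace_kroneckerSum_re hN, Matrix.trace_mul_comm, ← trace_compress_mul s _ hΓs, h0]
    simp
  obtain ⟨δ₀, -, h1⟩ := hint 0 isHermitian_zero
  obtain ⟨δ, hδ, h2⟩ := hint W hW
  have h3 := hzero _ h1
  have h4 := hzero _ h2
  rw [smul_zero, add_zero] at h3
  rw [Matrix.mul_add, trace_add, Complex.add_re, h3, zero_add, Matrix.mul_smul, trace_smul,
    smul_eq_mul, Complex.re_ofReal_mul, mul_eq_zero, or_iff_right hδ.ne'] at h4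
  rw [← sub_eq_zero, ← hWdef]
  ext i j
  have h5 := normSq_le_trace_mul_self hW i j
  rw [h4] at h5
  exact Complex.normSq_eq_zero.1 (le_antisymm h5 (Complex.normSq_nonneg _))

/-- Stationarity without penalty (`η = 0`) is exactly the marginal constraint. -/
lemma isAdmissible_gibbs_of_isDualMaximiser (hN : 1 ≤ N) (hε : 0 < ε) (hH : H.IsHermitian)
    (hγ : IsDensity γ) {U : OneBody d} (hU : IsDualMaximiser s ε H γ U) :
    IsAdmissible s γ (gibbs s ε H U) := by
  have hN0 : (N : ℝ) ≠ 0 := by exact_mod_cast (Nat.one_le_iff_ne_zero.1 hN)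
  have hpsd := posSemidef_gibbs s ε hH hU.1
  have hcomp := compress_gibbs s ε hH hU.1
  have hmarg : HasMarginals (gibbs s ε H U) γ := by
    refine hasMarginals_of_hermitian hpsd.1 hcomp hγ.1.1 fun W hW => ?_
    have h := euler_lagrange (s := s) (η := 0) (γ := γ) hε hH hU.1
      (fun V hV => by simpa [penalisedDual] using hU.2 V hV) hW
    rw [zero_mul, sub_eq_zero, eq_div_iff hN0] at h
    linarith
  exact ⟨⟨⟨hpsd, by rw [hmarg.trace_eq hN, hγ.2]⟩, hcomp⟩, hmarg⟩

/-- The Gibbs operator of a maximiser closes the duality gap. Any other optimiser, primal or dual,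
closes it too, so the equality case identifies the Gibbs operators, and these determine the
potential. -/
theorem uniqueOptimisers_of_interior (hN : 1 ≤ N) (hε : 0 < ε) (hH : H.IsHermitian)
    (hγ : IsDensity γ)
    (hint : ∀ E : OneBody d, E.IsHermitian →
      ∃ δ : ℝ, 0 < δ ∧ IsRepresentable s N (γ + (δ : ℂ) • E)) :
    UniqueOptimisers s ε H γ := by
  obtain ⟨U, hU⟩ := exists_dualFunctional_maximiser hN hε hH hint
  have hadm := isAdmissible_gibbs_of_isDualMaximiser hN hε hH hγ hU
  have hval : dualFunctional s ε H γ U = primalEnergy ε H (gibbs s ε H U) :=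
    (dualFunctional_le_primalEnergy hN hε hH hU.1 hadm).2.2 rfl
  refine ⟨U, hU, fun V hV => ?_, ⟨hadm, fun Γ hΓ => ?_⟩, fun Γ hΓ => ?_⟩
  · refine (eq_of_gibbs_eq hN hε hH hint hU.1 hV.1 ?_).symm
    refine (dualFunctional_le_primalEnergy hN hε hH hV.1 hadm).2.1 ?_
    rw [← hval]
    exact le_antisymm (hU.2 V hV.1) (hV.2 U hU.1)
  · rw [← hval]
    exact (dualFunctional_le_primalEnergy hN hε hH hU.1 hΓ).1
  · have h := dualFunctional_le_primalEnergy hN hε hH hU.1 hΓ.1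
    exact h.2.1 (le_antisymm h.1 (hval ▸ hΓ.2 _ hadm))

lemma IsRepresentable.exists_isAdmissible (hN : 1 ≤ N) (hγ : IsDensity γ)
    (h : IsRepresentable s N γ) : ∃ Γ : ManyBody N d, IsAdmissible s γ Γ := by
  obtain ⟨Γ, h1, h2, h3⟩ := h
  exact ⟨Γ, ⟨⟨h1, by rw [h3.trace_eq hN, hγ.2]⟩, h2⟩, h3⟩

end Duality

end QuantumOT

theorem mainTheorem4 (N d : ℕ) (hN : 1 ≤ N) (ε : ℝ) (hε : 0 < ε)
    (H : ManyBody N d) (hH : H.IsHermitian) (hsym : IsPermSymmetric H) :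
    (∀ γ : OneBody d, IsDensity γ → ((N : ℂ)⁻¹ • (1 : OneBody d) - γ).PosSemidef →
      DualityHolds .fermion ε H γ ∧
      (γ.PosDef → ((N : ℂ)⁻¹ • (1 : OneBody d) - γ).PosDef →
        UniqueOptimisers .fermion ε H γ)) ∧
    (∀ γ : OneBody d, IsDensity γ →
      DualityHolds .boson ε H γ ∧
      (γ.PosDef → UniqueOptimisers .boson ε H γ)) := by
  refine ⟨fun γ hγ hP => ⟨?_, fun hpos hPpos => ?_⟩, fun γ hγ => ⟨?_, fun hpos => ?_⟩⟩
  · obtain ⟨Γ, hΓ⟩ := (isRepresentable_fermion_of_trace_eq_one hN hγ.1 hγ.2 hP).exists_isAdmissible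
      hN hγ
    exact dualityHolds_of_admissible hN hε hH hγ hΓ
  · exact uniqueOptimisers_of_interior hN hε hH hγ fun E hE =>
      exists_isRepresentable_fermion_add_smul hN hpos hγ.2 hPpos hE
  · obtain ⟨Γ, hΓ⟩ := (isRepresentable_boson N hγ.1).exists_isAdmissible hN hγ
    exact dualityHolds_of_admissible hN hε hH hγ hΓ
  · exact uniqueOptimisers_of_interior hN hε hH hγ fun E hE =>
      exists_isRepresentable_boson_add_smul N hpos hE
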